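/- Let $n\ge 1$ and let $G$ be the simply connected simple algebraic group over $\mathbb C$ of type $B_n$, with simple roots $\alpha_1,\dots,\alpha_n$ ($\alpha_n$ short), Chevalley generators $e_i,f_i,h_i$, simple reflections $s_i$, fundamental weights $\Lambda_i$, longest Weyl group element $w_0$, maximal torus $T$ and opposite maximal unipotent subgroups $U^+,U^-$. Put $x_i(t)=\exp(te_i)$, $y_i(t)=\exp(tf_i)$, let $\alpha_i^\vee(c)\in T$ ($c\in\mathbb C^\times$) be the coroot subgroup, $\bar s_i=x_i(-1)y_i(1)x_i(-1)$, and $\bar w=\bar s_{i_1}\cdots\bar s_{i_k}$ for any reduced word $w=s_{i_1}\cdots s_{i_k}$. Let $\Delta_{\Lambda_n}$ be the unique regular function on $G$ with $\Delta_{\Lambda_n}(u^-tu^+)=\Lambda_n(t)$ for $u^\pm\in U^\pm$, $t\in T$, and for $\gamma=u\Lambda_n$, $\delta=v\Lambda_n$ with $u,v$ in the Weyl group let $\Delta_{\gamma,\delta}(g)=\Delta_{\Lambda_n}(\bar u^{-1}g\bar v)$ be the generalized minor, which depends only on $\gamma$ and $\delta$. For $c=(c_i^{(j)})_{1\le i,j\le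 n}\in(\mathbb C^\times)^{n^2}$ and the word $\mathbf i_0=(1\,2\cdots n)^n$ put $$\Theta^-_{\mathbf i_0}(c)=\prod_{j=1,\dots,n}^{\rightarrow}\ \prod_{i=1,\dots,n}^{\rightarrow}\mathbf y_i\bigl(c_i^{(j)}\bigr),\qquad \mathbf y_i(c)=y_i(c)\,\alpha_i^\vee(c^{-1}),$$ where the factors are written from left to right in increasing order of $j$, and of $i$ for each $j$. A *triangle* is a family of integers $\delta=(j_k^{(l)})_{1\le k\le l\le n}$ with $1\le j_k^{(l)}\le n+1$ for all $1\le k\le l\le n$ and $j_k^{(l+1)}\le j_k^{(l)}<j_{k+1}^{(l+1)}$ for $1\le k\le l<n$; let $\triangle_n$ be the set of triangles and $\delta_l\in\triangle_n$ the triangle with $j_k^{(l)}=k$ for all $k,l$. For $\delta\in\triangle_n$ and $1\le k\le n$ there is a unique $s_k\in\{1,\dots,k+1\}$ such that $j_m^{(k)}=m$ for $m<s_k$ and $j_m^{(k)}=m+1$ for $s_k\le m\le k$. Put $s_0=1$ and $s_{n+1}=s_{n-1}+1$. The $k$-th row of $\delta$ is of type I if $s_{k+1}=s_k+1$, $s_k=s_{k-1}$;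 of type II if $s_{k+1}=s_k=s_{k-1}$; of type III if $s_{k+1}=s_k+1$, $s_k=s_{k-1}+1$; of type IV if $s_{k+1}=s_k$, $s_k=s_{k-1}+1$. Let $$m(\delta)=\prod_{i\text{-th row of type I}}c_i^{(s_i)}\prod_{i\text{-th row of type IV}}\bigl(c_i^{(s_i)}\bigr)^{-1},$$ and let $\overline{m(\delta)}$ be obtained from $m(\delta)$ by the substitution $c_i^{(j)}\mapsto\bigl(c_i^{(n-j+1)}\bigr)^{-1}$. Then $$\Delta_{w_0s_n\Lambda_n,\Lambda_n}\bigl(\Theta^-_{\mathbf i_0}(c)\bigr)=\sum_{\delta\in\triangle_n\setminus\{\delta_l\}}\overline{m(\delta)}\qquad\text{for all }c\in(\mathbb C^\times)^{n^2}.$$ -/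

import Mathlib

namespace TypeB

/-! ### Root data of type `B_n`

The index set `I = {1, …, n}` is `Fin n`; the element `i : Fin n` stands for the index `i + 1`. -/

/-- The index `n ∈ I`. -/
def lastIdx (n : ℕ) (hn : 1 ≤ n) : Fin n := ⟨n - 1, by omega⟩

/-- The Cartan matrix `a_{i,j} = α_j(h_i)` of type `B_n`; `α_n` is the short root. -/
def cartan (n : ℕ) (i j : Fin n) : ℤ :=
  if i = j then 2
  else if (i : ℕ) + 1 = j then -1
  else if (j : ℕ) + 1 = i then (if (i : ℕ) + 1 = n then -2 else -1)
  else 0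

/-- The weight lattice `P`; the weight `wt` is given by its values `wt i = ⟨h_i, wt⟩` on the simple
coroots, that is, by its coordinates in the basis of fundamental weights. -/
abbrev Weight (n : ℕ) : Type := Fin n → ℤ

/-- The fundamental weight `Λ_i`. -/
def fundWeight {n : ℕ} (i : Fin n) : Weight n := Pi.single i 1

/-- The simple root `α_j`. -/
def simpleRoot {n : ℕ} (j : Fin n) : Weight n := fun i => cartan n i j

theorem reflection_involutive {n : ℕ} (i : Fin n) :
    Function.Involutive (fun wt : Weight n => wt - wt i • simpleRoot i) := by
  intro wt
  funext k
  simp only [Pi.sub_apply, Pi.smul_apply, smul_eq_mul]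
  have h : (simpleRoot i : Weight n) i = 2 := by simp [simpleRoot, cartan]
  rw [h]
  ring

/-- The simple reflection `s_i : wt ↦ wt - ⟨h_i, wt⟩ α_i`. -/
def simpleReflection {n : ℕ} (i : Fin n) : Equiv.Perm (Weight n) :=
  (reflection_involutive i).toPerm

/-- The Weyl group. -/
def weylGroup (n : ℕ) : Subgroup (Equiv.Perm (Weight n)) :=
  Subgroup.closure (Set.range simpleReflection)

/-- The element `s_{i_1} ⋯ s_{i_k}` of the Weyl group given by a word `i_1 ⋯ i_k`. -/
def wordProd {n : ℕ} (a : List (Fin n)) : Equiv.Perm (Weight n) :=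
  (a.map simpleReflection).prod

/-- The length of an element of the Weyl group. -/
noncomputable def weylLength {n : ℕ} (w : Equiv.Perm (Weight n)) : ℕ :=
  sInf {k | ∃ a : List (Fin n), a.length = k ∧ wordProd a = w}

/-- A word is reduced if no shorter word gives the same element of the Weyl group. -/
def IsReducedWord {n : ℕ} (a : List (Fin n)) : Prop :=
  weylLength (wordProd a) = a.length

/-- `w₀` is the longest element of the Weyl group. -/
def IsLongest {n : ℕ} (w₀ : Equiv.Perm (Weight n)) : Prop :=
  w₀ ∈ weylGroup n ∧ ∀ w ∈ weylGroup n, weylLength w ≤ weylLength w₀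

/-! ### The spin representation -/

/-- The basis `(ε_1, …, ε_n)`, `ε_i ∈ {+, -}`, of the spin representation; `true` is `+`. -/
abbrev Spin (n : ℕ) : Type := Fin n → Bool

/-- The action of `e_i` on basis vectors (`none` is the zero vector). -/
def raise {n : ℕ} (i : Fin n) (ε : Spin n) : Option (Spin n) :=
  if h : (i : ℕ) + 1 < n then
    if ε i = false ∧ ε ⟨i + 1, h⟩ = true then
      some (Function.update (Function.update ε i true) ⟨i + 1, h⟩ false)
    else none
  else if ε i = false then some (Function.update ε i true) else none

/-- The action of `f_i` on basis vectors (`none` is the zero vector). -/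
def lower {n : ℕ} (i : Fin n) (ε : Spin n) : Option (Spin n) :=
  if h : (i : ℕ) + 1 < n then
    if ε i = true ∧ ε ⟨i + 1, h⟩ = false then
      some (Function.update (Function.update ε i false) ⟨i + 1, h⟩ true)
    else none
  else if ε i = true then some (Function.update ε i false) else none

/-- The eigenvalue of `h_i` on the basis vector `ε`: it is `(ε_i - ε_{i+1}) / 2` for `i ≠ n`,
and `ε_n` for `i = n`. -/
def hval {n : ℕ} (i : Fin n) (ε : Spin n) : ℤ :=
  if h : (i : ℕ) + 1 < n then
    if ε i = true ∧ ε ⟨i + 1, h⟩ = false then 1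
    else if ε i = false ∧ ε ⟨i + 1, h⟩ = true then -1
    else 0
  else if ε i = true then 1 else -1

/-- The matrix of `e_i` in the basis `Spin n`. -/
def eMat {n : ℕ} (i : Fin n) : Matrix (Spin n) (Spin n) ℂ :=
  Matrix.of fun ε' ε => if raise i ε = some ε' then 1 else 0

/-- The matrix of `f_i` in the basis `Spin n`. -/
def fMat {n : ℕ} (i : Fin n) : Matrix (Spin n) (Spin n) ℂ :=
  Matrix.of fun ε' ε => if lower i ε = some ε' then 1 else 0

theorem raise_raise {n : ℕ} (i : Fin n) (ε ε' : Spin n) (h : raise i ε = some ε') :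
    raise i ε' = none := by
  unfold raise at h ⊢
  split_ifs at h ⊢ <;> simp_all
  · subst h; simp_all [Fin.ext_iff]
  · subst h; simp_all

theorem lower_lower {n : ℕ} (i : Fin n) (ε ε' : Spin n) (h : lower i ε = some ε') :
    lower i ε' = none := by
  unfold lower at h ⊢
  split_ifs at h ⊢ <;> simp_all
  · subst h; simp_all [Fin.ext_iff]
  · subst h; simp_all

theorem eMat_mul_self {n : ℕ} (i : Fin n) : eMat i * eMat i = 0 := by
  ext a b
  simp only [eMat, Matrix.mul_apply, Matrix.of_apply, Matrix.zero_apply]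
  refine Finset.sum_eq_zero fun k _ => ?_
  by_cases h : raise i b = some k
  · simp [raise_raise i b k h]
  · simp [h]

theorem fMat_mul_self {n : ℕ} (i : Fin n) : fMat i * fMat i = 0 := by
  ext a b
  simp only [fMat, Matrix.mul_apply, Matrix.of_apply, Matrix.zero_apply]
  refine Finset.sum_eq_zero fun k _ => ?_
  by_cases h : lower i b = some k
  · simp [lower_lower i b k h]
  · simp [h]

theorem isNilpotent_smul_eMat {n : ℕ} (i : Fin n) (t : ℂ) : IsNilpotent (t • eMat i) :=
  ⟨2, by rw [sq, smul_mul_smul_comm, eMat_mul_self, smul_zero]⟩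

theorem isNilpotent_smul_fMat {n : ℕ} (i : Fin n) (t : ℂ) : IsNilpotent (t • fMat i) :=
  ⟨2, by rw [sq, smul_mul_smul_comm, fMat_mul_self, smul_zero]⟩

/-! ### The group `G`

The simply connected simple algebraic group `G` over `ℂ` of type `B_n` is realized as the Chevalley
group of the spin representation. This representation is faithful, because its weights generate the
weight lattice. -/

/-- `exp (t e_i)`. -/
noncomputable def expE {n : ℕ} (i : Fin n) (t : ℂ) : Matrix.GeneralLinearGroup (Spin n) ℂ where
  val := IsNilpotent.exp (t • eMat i)
  inv := IsNilpotent.exp (-(t • eMat i))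
  val_inv := IsNilpotent.exp_mul_exp_neg_self (isNilpotent_smul_eMat i t)
  inv_val := IsNilpotent.exp_neg_mul_exp_self (isNilpotent_smul_eMat i t)

/-- `exp (t f_i)`. -/
noncomputable def expF {n : ℕ} (i : Fin n) (t : ℂ) : Matrix.GeneralLinearGroup (Spin n) ℂ where
  val := IsNilpotent.exp (t • fMat i)
  inv := IsNilpotent.exp (-(t • fMat i))
  val_inv := IsNilpotent.exp_mul_exp_neg_self (isNilpotent_smul_fMat i t)
  inv_val := IsNilpotent.exp_neg_mul_exp_self (isNilpotent_smul_fMat i t)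

/-- `c ^ h_i`, the diagonal matrix acting on each basis vector by `c` to the power of the
eigenvalue of `h_i`. -/
def powH {n : ℕ} (i : Fin n) (c : ℂˣ) : Matrix.GeneralLinearGroup (Spin n) ℂ where
  val := Matrix.diagonal fun ε => ((c ^ hval i ε : ℂˣ) : ℂ)
  inv := Matrix.diagonal fun ε => ((c ^ (-hval i ε) : ℂˣ) : ℂ)
  val_inv := by
    rw [Matrix.diagonal_mul_diagonal, ← Matrix.diagonal_one]
    congr 1
    funext ε
    rw [← Units.val_mul, ← zpow_add, add_neg_cancel, zpow_zero, Units.val_one]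
  inv_val := by
    rw [Matrix.diagonal_mul_diagonal, ← Matrix.diagonal_one]
    congr 1
    funext ε
    rw [← Units.val_mul, ← zpow_add, neg_add_cancel, zpow_zero, Units.val_one]

/-- The group `G`, generated by the one-parameter subgroups of the simple and the negative simple
roots, and by the maximal torus. -/
def G (n : ℕ) : Subgroup (Matrix.GeneralLinearGroup (Spin n) ℂ) :=
  Subgroup.closure
    ({g | ∃ (i : Fin n) (t : ℂ), g = expE i t} ∪ {g | ∃ (i : Fin n) (t : ℂ), g = expF i t} ∪
      {g | ∃ (i : Fin n) (c : ℂˣ), g = powH i c})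

/-- `x_i(t) = exp (t e_i) ∈ G`. -/
noncomputable def xSub {n : ℕ} (i : Fin n) (t : ℂ) : G n :=
  ⟨expE i t, Subgroup.subset_closure (Or.inl (Or.inl ⟨i, t, rfl⟩))⟩

/-- `y_i(t) = exp (t f_i) ∈ G`. -/
noncomputable def ySub {n : ℕ} (i : Fin n) (t : ℂ) : G n :=
  ⟨expF i t, Subgroup.subset_closure (Or.inl (Or.inr ⟨i, t, rfl⟩))⟩

/-- `α_i^∨(c) = c ^ h_i ∈ G`. -/
def alphaCheck {n : ℕ} (i : Fin n) (c : ℂˣ) : G n :=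
  ⟨powH i c, Subgroup.subset_closure (Or.inr ⟨i, c, rfl⟩)⟩

/-- The maximal unipotent subgroup `U = U⁺`. It is generated by the root subgroups of the simple roots
(these generate the root subgroups of all the positive roots). -/
def Uplus (n : ℕ) : Subgroup (G n) :=
  Subgroup.closure {g | ∃ (i : Fin n) (t : ℂ), g = xSub i t}

/-- The opposite maximal unipotent subgroup `U⁻`, generated likewise. -/
def Uminus (n : ℕ) : Subgroup (G n) :=
  Subgroup.closure {g | ∃ (i : Fin n) (t : ℂ), g = ySub i t}

/-- The element `∏ α_i^∨(t_i)` of the maximal torus `T`; as `G` is simply connected, each element of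
`T` is of this form, and a weight `μ` takes on it the value `∏ t_i ^ ⟨h_i, μ⟩`. -/
def torus {n : ℕ} (t : Fin n → ℂˣ) : G n :=
  (List.ofFn fun i => alphaCheck i (t i)).prod

/-- The representative `s̄_i = x_i(-1) y_i(1) x_i(-1)` of `s_i`. -/
noncomputable def sbar {n : ℕ} (i : Fin n) : G n :=
  xSub i (-1) * ySub i 1 * xSub i (-1)

/-- The product `s̄_{i_1} ⋯ s̄_{i_k}`; for a reduced word this is the representative `w̄` of
`w = s_{i_1} ⋯ s_{i_k}`. -/
noncomputable def wordLift {n : ℕ} (a : List (Fin n)) : G n := (a.map sbar).prod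

/-! ### Generalized minors -/

/-- A regular function on `G`: a polynomial in the matrix entries (the determinant is `1` on `G`). -/
def IsRegular {n : ℕ} (D : G n → ℂ) : Prop :=
  ∃ p : MvPolynomial (Spin n × Spin n) ℂ, ∀ g : G n,
    D g = MvPolynomial.eval (fun ab => (g : Matrix.GeneralLinearGroup (Spin n) ℂ) ab.1 ab.2) p

/-- `D` is the principal minor `Δ_μ`: the regular function on `G` such that
`Δ_μ(u⁻ t u⁺) = μ(t)` for `u^± ∈ U^±` and `t ∈ T`. -/
def IsPrincipalMinor {n : ℕ} (μ : Weight n) (D : G n → ℂ) : Prop :=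
  IsRegular D ∧ ∀ u ∈ Uminus n, ∀ v ∈ Uplus n, ∀ t : Fin n → ℂˣ,
    D (u * torus t * v) = ((∏ i, t i ^ μ i : ℂˣ) : ℂ)

/-- `D` is the generalized minor `Δ_{γ,δ}`, where `γ = uμ` and `δ = vμ` with `u`, `v` in the Weyl
group: `Δ_{γ,δ}(g) = Δ_μ(ū⁻¹ g v̄)`. -/
def IsGeneralizedMinor {n : ℕ} (μ γ δ : Weight n) (D : G n → ℂ) : Prop :=
  ∃ D₀ : G n → ℂ, IsPrincipalMinor μ D₀ ∧
    ∃ a b : List (Fin n), IsReducedWord a ∧ IsReducedWord b ∧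
      wordProd a μ = γ ∧ wordProd b μ = δ ∧
      ∀ g, D g = D₀ ((wordLift a)⁻¹ * g * wordLift b)

/-! ### The map `Θ⁻` for the word `(1 2 ⋯ n)^n`

The variables are `c i j = c_i^{(j)}`, and `j` runs over all of `ℤ`; only those with `1 ≤ j ≤ n`
occur in `Θ⁻`. -/

/-- `𝐲_i(c) = y_i(c) α_i^∨(c⁻¹)`. -/
noncomputable def yBold {n : ℕ} (i : Fin n) (c : ℂˣ) : G n :=
  ySub i (c : ℂ) * alphaCheck i c⁻¹

/-- `Θ⁻(c) = (𝐲_1(c_1^{(1)}) ⋯ 𝐲_n(c_n^{(1)})) ⋯ (𝐲_1(c_1^{(n)}) ⋯ 𝐲_n(c_n^{(n)}))`. -/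
noncomputable def Theta {n : ℕ} (c : Fin n → ℤ → ℂˣ) : G n :=
  (List.ofFn fun j : Fin n =>
    (List.ofFn fun i : Fin n => yBold i (c i (((j : ℕ) : ℤ) + 1))).prod).prod

/-! ### Triangles -/

/-- Triangular arrays with `n` rows; `t l k` is the entry `j_{k+1}^{(l+1)}`, that is, the entry with
index `k + 1` in row `l + 1`, which has `l + 1` entries. -/
abbrev TriArray (n : ℕ) : Type := (l : Fin n) → Fin ((l : ℕ) + 1) → Fin (n + 2)

/-- The conditions `1 ≤ j_k^{(l)} ≤ n + 1` for `1 ≤ k ≤ l ≤ n`, and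
`j_k^{(l+1)} ≤ j_k^{(l)} < j_{k+1}^{(l+1)}` for `1 ≤ k ≤ l < n`. -/
def IsTriangle {n : ℕ} (t : TriArray n) : Prop :=
  (∀ (l : Fin n) (k : Fin ((l : ℕ) + 1)), 1 ≤ (t l k : ℕ) ∧ (t l k : ℕ) ≤ n + 1) ∧
  ∀ (l : Fin n) (h : (l : ℕ) + 1 < n) (k : Fin ((l : ℕ) + 1)),
    t ⟨l + 1, h⟩ k.castSucc ≤ t l k ∧ t l k < t ⟨l + 1, h⟩ k.succ

instance {n : ℕ} : DecidablePred (IsTriangle (n := n)) := fun t => by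
  unfold IsTriangle; infer_instance

/-- The set of triangles. -/
def triangles (n : ℕ) : Finset (TriArray n) := Finset.univ.filter IsTriangle

/-- The triangle `δ_l`, with `j_k^{(l)} = k` for all `k`, `l`. -/
def lowestTriangle (n : ℕ) : TriArray n := fun l k => ⟨(k : ℕ) + 1, by omega⟩

/-- Row `r = l + 1` of `t` is `(r + 1, r, …, s + 1, s - 1, …, 2, 1)` (written from the last entry
to the first): its entry with index `m` is `m` for `m < s`, and `m + 1` for `m ≥ s`. -/
def IsRowLabel {n : ℕ} (t : TriArray n) (l : Fin n) (s : ℕ) : Prop :=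
  1 ≤ s ∧ s ≤ (l : ℕ) + 2 ∧
    ∀ k : Fin ((l : ℕ) + 1), (t l k : ℕ) = if (k : ℕ) + 1 < s then (k : ℕ) + 1 else (k : ℕ) + 2

/-- The number `s` with `IsRowLabel t l s`; each row of a triangle has exactly one. -/
noncomputable def rowLabel {n : ℕ} (t : TriArray n) (l : Fin n) : ℕ := sInf {s | IsRowLabel t l s}

/-- The label `(s_1, …, s_n)` of a triangle, extended by `s_0 = 1`. -/
noncomputable def label₀ {n : ℕ} (t : TriArray n) (r : ℕ) : ℕ :=
  if h : 1 ≤ r ∧ r ≤ n then rowLabel t ⟨r - 1, by omega⟩ else 1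

/-- The label `(s_1, …, s_n)` of a triangle, extended by `s_0 = 1` and `s_{n+1} = s_{n-1} + 1`. -/
noncomputable def label {n : ℕ} (t : TriArray n) (r : ℕ) : ℕ :=
  if r = n + 1 then label₀ t (n - 1) + 1 else label₀ t r

/-- Row `r` is of type I. -/
def IsTypeI {n : ℕ} (t : TriArray n) (r : ℕ) : Prop :=
  label t (r + 1) = label t r + 1 ∧ label t r = label t (r - 1)

/-- Row `r` is of type IV. -/
def IsTypeIV {n : ℕ} (t : TriArray n) (r : ℕ) : Prop :=
  label t (r + 1) = label t r ∧ label t r = label t (r - 1) + 1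

open Classical in
/-- The Laurent monomial `m(δ)`, as a function of the variables `c i j = c_i^{(j)}`: a row `i` of
type I contributes `c_i^{(s_i)}`, one of type IV contributes `(c_i^{(s_i)})⁻¹`, and the rows of the
other two types contribute `1`. -/
noncomputable def mono {n : ℕ} (t : TriArray n) (c : Fin n → ℤ → ℂˣ) : ℂˣ :=
  ∏ i : Fin n,
    if IsTypeI t ((i : ℕ) + 1) then c i (label t ((i : ℕ) + 1))
    else if IsTypeIV t ((i : ℕ) + 1) then (c i (label t ((i : ℕ) + 1)))⁻¹
    else 1

/-- The monomial obtained from `m(δ)` by the substitution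
`c_i^{(j)} ↦ (c_i^{(n - j + 1)})⁻¹`. -/
noncomputable def monoBar {n : ℕ} (t : TriArray n) (c : Fin n → ℤ → ℂˣ) : ℂˣ :=
  mono t fun i j => (c i ((n : ℤ) - j + 1))⁻¹

end TypeB

open TypeB

namespace TypeB
variable {n : ℕ}

theorem lower_eq_some_iff {i : Fin n} {a b : Spin n} : lower i a = some b ↔
    a i = true ∧ (∀ k : Fin n, (k : ℕ) = i + 1 → a k = false) ∧
      ∀ k : Fin n, b k = if k = i then false else if (k : ℕ) = i + 1 then true else a k := by
  unfold lower
  constructor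
  · intro h
    split_ifs at h with h1 h2 h3 <;> simp at h <;> subst h
    · refine ⟨h2.1, fun k hk => ?_, fun k => ?_⟩
      · rw [← h2.2]; congr 1; ext; exact hk
      · simp only [Function.update_apply, Fin.ext_iff]
        split_ifs <;> first | rfl | omega
    · refine ⟨h3, fun k hk => ?_, fun k => ?_⟩
      · exact absurd k.2 (by omega)
      · have : (k : ℕ) ≠ i + 1 := by have := k.2; omega
        simp [Function.update_apply, this]
  · rintro ⟨h1, h2, h3⟩
    have hb : b = fun k : Fin n => if k = i then false else if (k : ℕ) = i + 1 then true else a k :=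
      funext h3
    split_ifs with h h1'
    · rw [hb]; congr 1; funext k
      simp only [Function.update_apply, Fin.ext_iff]
      split_ifs <;> first | rfl | omega
    · exact absurd ⟨h1, h2 _ rfl⟩ h1'
    · rw [hb]; congr 1; funext k
      have : (k : ℕ) ≠ i + 1 := by have := k.2; omega
      simp [Function.update_apply, this]

theorem raise_eq_some_iff' {i : Fin n} {a b : Spin n} : raise i a = some b ↔
    a i = false ∧ (∀ k : Fin n, (k : ℕ) = i + 1 → a k = true) ∧
      ∀ k : Fin n, b k = if k = i then true else if (k : ℕ) = i + 1 then false else a k := by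
  unfold raise
  constructor
  · intro h
    split_ifs at h with h1 h2 h3 <;> simp at h <;> subst h
    · refine ⟨h2.1, fun k hk => ?_, fun k => ?_⟩
      · rw [← h2.2]; congr 1; ext; exact hk
      · simp only [Function.update_apply, Fin.ext_iff]
        split_ifs <;> first | rfl | omega
    · refine ⟨h3, fun k hk => ?_, fun k => ?_⟩
      · exact absurd k.2 (by omega)
      · have : (k : ℕ) ≠ i + 1 := by have := k.2; omega
        simp [Function.update_apply, this]
  · rintro ⟨h1, h2, h3⟩
    have hb : b = fun k : Fin n => if k = i then true else if (k : ℕ) = i + 1 then false else a k :=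
      funext h3
    split_ifs with h h1'
    · rw [hb]; congr 1; funext k
      simp only [Function.update_apply, Fin.ext_iff]
      split_ifs <;> first | rfl | omega
    · exact absurd ⟨h1, h2 _ rfl⟩ h1'
    · rw [hb]; congr 1; funext k
      have : (k : ℕ) ≠ i + 1 := by have := k.2; omega
      simp [Function.update_apply, this]

theorem exists_lower {i : Fin n} {a : Spin n} (h : a i = true)
    (h' : ∀ k : Fin n, (k : ℕ) = i + 1 → a k = false) : ∃ b, lower i a = some b :=
  ⟨_, lower_eq_some_iff.2 ⟨h, h', fun _ => rfl⟩⟩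

theorem exists_raise {i : Fin n} {a : Spin n} (h : a i = false)
    (h' : ∀ k : Fin n, (k : ℕ) = i + 1 → a k = true) : ∃ b, raise i a = some b :=
  ⟨_, raise_eq_some_iff'.2 ⟨h, h', fun _ => rfl⟩⟩

theorem raise_eq_some_iff {i : Fin n} {a b : Spin n} :
    raise i a = some b ↔ lower i b = some a := by
  rw [lower_eq_some_iff, raise_eq_some_iff']
  constructor
  · rintro ⟨h1, h2, h3⟩
    refine ⟨by simp [h3], fun k hk => ?_, fun k => ?_⟩
    · have : k ≠ i := by rintro rfl; omega
      simp [h3, hk, this]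
    · by_cases hk : k = i
      · simp [hk, h1]
      · by_cases hk' : (k : ℕ) = i + 1
        · simp [hk, hk', h2 k hk']
        · simp [hk, hk', h3]
  · rintro ⟨h1, h2, h3⟩
    refine ⟨by simp [h3], fun k hk => ?_, fun k => ?_⟩
    · have : k ≠ i := by rintro rfl; omega
      simp [h3, hk, this]
    · by_cases hk : k = i
      · simp [hk, h1]
      · by_cases hk' : (k : ℕ) = i + 1
        · simp [hk, hk', h2 k hk']
        · simp [hk, hk', h3]

theorem hval_of_lower {i : Fin n} {a b : Spin n} (h : lower i a = some b) :
    hval i a = 1 ∧ hval i b = -1 := by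
  unfold lower at h
  unfold hval
  split_ifs at h ⊢ <;> simp_all <;> subst h <;> simp_all [Fin.ext_iff]

theorem hval_of_none {i : Fin n} {a : Spin n} (h : lower i a = none) (h' : raise i a = none) :
    hval i a = 0 := by
  unfold lower at h
  unfold raise at h'
  unfold hval
  split_ifs at h h' ⊢ <;> simp_all

/-- The sign of a spin coordinate. -/
def sgn (x : Bool) : ℤ := if x then 1 else -1

theorem two_mul_hval_of_lt {i : Fin n} (h : (i : ℕ) + 1 < n) (a : Spin n) :
    2 * hval i a = sgn (a i) - sgn (a ⟨i + 1, h⟩) := by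
  unfold hval sgn
  rw [dif_pos h]
  cases a i <;> cases a ⟨i + 1, h⟩ <;> simp

theorem hval_of_not_lt {i : Fin n} (h : ¬ (i : ℕ) + 1 < n) (a : Spin n) :
    hval i a = sgn (a i) := by
  unfold hval sgn
  rw [dif_neg h]

theorem sgn_lower {i : Fin n} {a b : Spin n} (h : lower i a = some b) (k : Fin n) :
    sgn (b k) = sgn (a k) - (if k = i then 2 else if (k : ℕ) = i + 1 then -2 else 0) := by
  obtain ⟨h1, h2, h3⟩ := lower_eq_some_iff.1 h
  rw [h3]
  split_ifs with h4 h5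
  · subst h4; simp [sgn, h1]
  · simp [sgn, h2 k h5]
  · simp

theorem hval_lower {j : Fin n} {a b : Spin n} (h : lower j a = some b) (i : Fin n) :
    hval i b = hval i a - cartan n i j := by
  have hi := i.2
  have hj := j.2
  by_cases hn : (i : ℕ) + 1 < n
  · suffices 2 * hval i b = 2 * (hval i a - cartan n i j) by omega
    rw [mul_sub, two_mul_hval_of_lt hn, two_mul_hval_of_lt hn, sgn_lower h, sgn_lower h]
    unfold cartan
    simp only [Fin.ext_iff]
    split_ifs <;> omega
  · rw [hval_of_not_lt hn, hval_of_not_lt hn, sgn_lower h]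
    unfold cartan
    simp only [Fin.ext_iff]
    split_ifs <;> omega

theorem lower_raise_of_ne {i j : Fin n} (hij : i ≠ j) {a b c : Spin n} (h : lower j a = some b)
    (h' : raise i b = some c) : ∃ d, raise i a = some d ∧ lower j d = some c := by
  have hij' : (i : ℕ) ≠ j := fun h => hij (Fin.ext h)
  obtain ⟨h1, h2, h3⟩ := lower_eq_some_iff.1 h
  obtain ⟨h4, h5, h6⟩ := raise_eq_some_iff'.1 h'
  have n1 : (i : ℕ) ≠ j + 1 := fun e => by simp [h3, hij, e] at h4
  have n2 : (j : ℕ) ≠ i + 1 := fun e => by have := h5 j e; simp [h3] at this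
  obtain ⟨d, hd⟩ := exists_raise (i := i) (a := a) (by simpa [h3, hij, n1] using h4)
    (fun k hk => by
      have := h5 k hk
      rw [h3, if_neg (by rw [Fin.ext_iff]; omega), if_neg (by omega)] at this
      exact this)
  refine ⟨d, hd, ?_⟩
  obtain ⟨-, -, h7⟩ := raise_eq_some_iff'.1 hd
  refine lower_eq_some_iff.2 ⟨?_, fun k hk => ?_, fun k => ?_⟩
  · simp [h7, hij.symm, n2, h1]
  · rw [h7, if_neg (by rw [Fin.ext_iff]; omega), if_neg (by omega), h2 k hk]
  · simp only [h6, h3, h7, Fin.ext_iff]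
    split_ifs <;> first | rfl | omega

theorem raise_lower_of_ne {i j : Fin n} (hij : i ≠ j) {a c d : Spin n} (h : raise i a = some d)
    (h' : lower j d = some c) : ∃ b, lower j a = some b ∧ raise i b = some c := by
  have hij' : (i : ℕ) ≠ j := fun h => hij (Fin.ext h)
  obtain ⟨h1, h2, h3⟩ := raise_eq_some_iff'.1 h
  obtain ⟨h4, h5, h6⟩ := lower_eq_some_iff.1 h'
  have n1 : (j : ℕ) ≠ i + 1 := fun e => by simp [h3, hij.symm, e] at h4
  have n2 : (i : ℕ) ≠ j + 1 := fun e => by have := h5 i e; simp [h3] at this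
  obtain ⟨b, hb⟩ := exists_lower (i := j) (a := a) (by simpa [h3, hij.symm, n1] using h4)
    (fun k hk => by
      have := h5 k hk
      rw [h3, if_neg (by rw [Fin.ext_iff]; omega), if_neg (by omega)] at this
      exact this)
  refine ⟨b, hb, ?_⟩
  obtain ⟨-, -, h7⟩ := lower_eq_some_iff.1 hb
  refine raise_eq_some_iff'.2 ⟨?_, fun k hk => ?_, fun k => ?_⟩
  · simp [h7, hij, n2, h1]
  · rw [h7, if_neg (by rw [Fin.ext_iff]; omega), if_neg (by omega), h2 k hk]
  · simp only [h6, h3, h7, Fin.ext_iff]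
    split_ifs <;> first | rfl | omega

/-! Matrix relations. -/

theorem eMat_transpose (i : Fin n) : (eMat i).transpose = fMat i := by
  ext a b
  simp [eMat, fMat, raise_eq_some_iff]

theorem fMat_transpose (i : Fin n) : (fMat i).transpose = eMat i := by
  rw [← eMat_transpose, Matrix.transpose_transpose]

theorem fMat_mulVec_apply (i : Fin n) (ψ : Spin n → ℂ) (a : Spin n) :
    (fMat i).mulVec ψ a = (raise i a).elim 0 ψ := by
  simp only [fMat, Matrix.mulVec, dotProduct, Matrix.of_apply, ← raise_eq_some_iff]
  cases raise i a <;> simp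

theorem eMat_mulVec_apply (i : Fin n) (ψ : Spin n → ℂ) (a : Spin n) :
    (eMat i).mulVec ψ a = (lower i a).elim 0 ψ := by
  simp only [eMat, Matrix.mulVec, dotProduct, Matrix.of_apply, raise_eq_some_iff]
  cases lower i a <;> simp

theorem matrix_ext_mulVec {A B : Matrix (Spin n) (Spin n) ℂ}
    (h : ∀ ψ a, A.mulVec ψ a = B.mulVec ψ a) : A = B :=
  Matrix.mulVec_injective (funext fun ψ => funext fun a => h ψ a)

theorem eMat_mul_fMat_of_ne {i j : Fin n} (hij : i ≠ j) : eMat i * fMat j = fMat j * eMat i := by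
  refine matrix_ext_mulVec fun ψ a => ?_
  rw [← Matrix.mulVec_mulVec, ← Matrix.mulVec_mulVec, fMat_mulVec_apply, eMat_mulVec_apply]
  rcases h1 : lower i a with _ | b <;> rcases h2 : raise j a with _ | d <;>
    simp only [Option.elim_none, Option.elim_some, fMat_mulVec_apply, eMat_mulVec_apply]
  · rcases h3 : lower i d with _ | c
    · rfl
    · obtain ⟨b, hb, -⟩ := raise_lower_of_ne hij.symm h2 h3
      simp [h1] at hb
  · rcases h3 : raise j b with _ | c
    · rfl
    · obtain ⟨b, hb, -⟩ := lower_raise_of_ne hij.symm h1 h3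
      simp [h2] at hb
  · rcases h3 : raise j b with _ | c
    · rcases h4 : lower i d with _ | c
      · rfl
      · obtain ⟨b', hb, hc⟩ := raise_lower_of_ne hij.symm h2 h4
        rw [h1] at hb; cases hb; simp [h3] at hc
    · obtain ⟨b', hb, hc⟩ := lower_raise_of_ne hij.symm h1 h3
      rw [h2] at hb; cases hb; simp [hc]

theorem eMat_mul_fMat_mul_eMat (i : Fin n) : eMat i * fMat i * eMat i = eMat i := by
  refine matrix_ext_mulVec fun ψ a => ?_
  rw [mul_assoc, ← Matrix.mulVec_mulVec, eMat_mulVec_apply]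
  rcases h : lower i a with _ | b
  · simp [eMat_mulVec_apply, h]
  · rw [Option.elim_some, ← Matrix.mulVec_mulVec, fMat_mulVec_apply, raise_eq_some_iff.2 h]
    simp

theorem fMat_mul_eMat_mul_fMat (i : Fin n) : fMat i * eMat i * fMat i = fMat i := by
  have := congrArg Matrix.transpose (eMat_mul_fMat_mul_eMat i)
  simpa [Matrix.transpose_mul, eMat_transpose, fMat_transpose, mul_assoc] using this

theorem expE_val (i : Fin n) (t : ℂ) : (expE i t).val = 1 + t • eMat i := by
  have h : (t • eMat i) ^ 2 = 0 := by rw [sq, smul_mul_smul_comm, eMat_mul_self, smul_zero]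
  simp [expE, IsNilpotent.exp_eq_sum h, Finset.sum_range_succ]

theorem expF_val (i : Fin n) (t : ℂ) : (expF i t).val = 1 + t • fMat i := by
  have h : (t • fMat i) ^ 2 = 0 := by rw [sq, smul_mul_smul_comm, fMat_mul_self, smul_zero]
  simp [expF, IsNilpotent.exp_eq_sum h, Finset.sum_range_succ]

theorem powH_val (i : Fin n) (c : ℂˣ) :
    (powH i c).val = 1 + ((c : ℂ) - 1) • (eMat i * fMat i) + ((c : ℂ)⁻¹ - 1) • (fMat i * eMat i) := by
  refine matrix_ext_mulVec fun ψ a => ?_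
  simp only [powH, Matrix.mulVec_diagonal, Matrix.add_mulVec, Matrix.one_mulVec, Matrix.smul_mulVec,
    ← Matrix.mulVec_mulVec, Pi.add_apply, Pi.smul_apply, smul_eq_mul]
  rw [eMat_mulVec_apply, fMat_mulVec_apply]
  rcases h1 : lower i a with _ | b <;> rcases h2 : raise i a with _ | d
  · simp [hval_of_none h1 h2]
  · have h3 := raise_eq_some_iff.1 h2
    simp [eMat_mulVec_apply, h3, (hval_of_lower h3).2]
    ring
  · simp [fMat_mulVec_apply, raise_eq_some_iff.2 h1, (hval_of_lower h1).1]
    ring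
  · have h3 := (hval_of_lower (raise_eq_some_iff.1 h2)).2
    rw [(hval_of_lower h1).1] at h3
    norm_num at h3

theorem expE_neg (i : Fin n) (t : ℂ) : (expE i t)⁻¹ = expE i (-t) := by
  rw [inv_eq_iff_mul_eq_one]
  ext1
  simp [expE_val, mul_add, add_mul, eMat_mul_self]

theorem expF_neg (i : Fin n) (t : ℂ) : (expF i t)⁻¹ = expF i (-t) := by
  rw [inv_eq_iff_mul_eq_one]
  ext1
  simp [expF_val, mul_add, add_mul, fMat_mul_self]

theorem expE_mul_expF_of_ne {i j : Fin n} (hij : i ≠ j) (a b : ℂ) :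
    expE i a * expF j b = expF j b * expE i a := by
  ext1
  simp [expE_val, expF_val, mul_add, add_mul, eMat_mul_fMat_of_ne hij, smul_smul, mul_comm a b]
  abel

theorem expE_mul_expF (i : Fin n) (a b : ℂ) (u : ℂˣ) (hu : (u : ℂ) = 1 + a * b) :
    expE i a * expF i b = expF i (b / u) * powH i u * expE i (a / u) := by
  have h1 := fMat_mul_self i
  have h2 := eMat_mul_self i
  have h3 := eMat_mul_fMat_mul_eMat i
  have h4 := fMat_mul_eMat_mul_fMat i
  have hu0 := u.ne_zero
  set e := eMat i
  set f := fMat i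
  ext1
  have k1 : f * (powH i u).val = (u : ℂ) • f := by
    rw [powH_val, mul_add, mul_add, mul_smul_comm, mul_smul_comm, ← mul_assoc, ← mul_assoc, h4, h1]
    simp [sub_smul]
  have k2 : (powH i u).val * e = (u : ℂ) • e := by
    rw [powH_val, add_mul, add_mul, smul_mul_assoc, smul_mul_assoc, h3, mul_assoc, h2]
    simp [sub_smul]
  simp only [Units.val_mul, expE_val, expF_val]
  change (1 + a • e) * (1 + b • f) = (1 + (b / (u : ℂ)) • f) * (powH i u).val * (1 + (a / (u : ℂ)) • e)
  rw [add_mul (1 : Matrix (Spin n) (Spin n) ℂ) ((b / (u : ℂ)) • f), one_mul, smul_mul_assoc, k1, smul_smul,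
    div_mul_cancel₀ _ hu0, mul_add ((powH i u).val + b • f), mul_one,
    add_mul (powH i u).val, mul_smul_comm (a / (u : ℂ)) (powH i u).val, k2, smul_smul,
    div_mul_cancel₀ _ hu0, powH_val]
  simp only [mul_add, add_mul, one_mul, mul_one, smul_mul_smul_comm]
  have e1 : (u : ℂ) - 1 = a * b := by rw [hu]; ring
  have e2 : (u : ℂ)⁻¹ - 1 = - (a / u * b) := by field_simp; rw [hu]; ring
  rw [e1, e2]
  module

theorem xSub_mul_ySub_of_ne {i j : Fin n} (hij : i ≠ j) (a b : ℂ) :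
    xSub i a * ySub j b = ySub j b * xSub i a :=
  Subtype.ext (expE_mul_expF_of_ne hij a b)

theorem xSub_mul_ySub (i : Fin n) (a b : ℂ) (u : ℂˣ) (hu : (u : ℂ) = 1 + a * b) :
    xSub i a * ySub i b = ySub i (b / u) * alphaCheck i u * xSub i (a / u) :=
  Subtype.ext (expE_mul_expF i a b u hu)

theorem xSub_inv (i : Fin n) (a : ℂ) : (xSub i a)⁻¹ = xSub i (-a) := Subtype.ext (expE_neg i a)

theorem ySub_inv (i : Fin n) (a : ℂ) : (ySub i a)⁻¹ = ySub i (-a) := Subtype.ext (expF_neg i a)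

theorem xSub_mem (i : Fin n) (a : ℂ) : xSub i a ∈ Uplus n := Subgroup.subset_closure ⟨i, a, rfl⟩

theorem ySub_mem (i : Fin n) (a : ℂ) : ySub i a ∈ Uminus n := Subgroup.subset_closure ⟨i, a, rfl⟩

/-! The torus. -/

theorem powH_mulVec_apply (i : Fin n) (c : ℂˣ) (ψ : Spin n → ℂ) (a : Spin n) :
    (powH i c).val.mulVec ψ a = ((c ^ hval i a : ℂˣ) : ℂ) * ψ a := by
  simp [powH, Matrix.mulVec_diagonal]

theorem torus_val (t : Fin n → ℂˣ) : (torus t : Matrix.GeneralLinearGroup (Spin n) ℂ).val =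
    Matrix.diagonal fun ε => ((∏ i, t i ^ hval i ε : ℂˣ) : ℂ) := by
  have key : ∀ l : List (Fin n), ((l.map fun i => alphaCheck i (t i)).prod :
      Matrix.GeneralLinearGroup (Spin n) ℂ).val =
      Matrix.diagonal fun ε => (((l.map fun i => t i ^ hval i ε).prod : ℂˣ) : ℂ) := by
    intro l
    induction l with
    | nil => simp
    | cons i l ih =>
      rw [List.map_cons, List.prod_cons, Subgroup.coe_mul, Units.val_mul, ih]
      simp only [alphaCheck, powH, Matrix.diagonal_mul_diagonal, List.map_cons, List.prod_cons,
        Units.val_mul]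
  have := key (List.finRange n)
  rw [← List.ofFn_eq_map] at this
  rw [torus, this]
  simp [← List.ofFn_eq_map, List.prod_ofFn]

theorem torus_mul (s t : Fin n → ℂˣ) : torus s * torus t = torus (s * t) := by
  apply Subtype.ext
  ext1
  rw [Subgroup.coe_mul, Units.val_mul, torus_val, torus_val, torus_val,
    Matrix.diagonal_mul_diagonal]
  congr 1
  funext ε
  simp [mul_zpow, Finset.prod_mul_distrib]

theorem torus_one : torus (1 : Fin n → ℂˣ) = 1 := by
  apply Subtype.ext
  ext1
  rw [torus_val]
  simp

theorem alphaCheck_eq_torus (i : Fin n) (c : ℂˣ) :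
    alphaCheck i c = torus (Pi.mulSingle i c) := by
  apply Subtype.ext
  ext1
  rw [torus_val]
  simp only [alphaCheck, powH]
  congr 1
  funext ε
  congr 1
  rw [Finset.prod_eq_single i]
  · simp
  · intro j _ hj; simp [hj]
  · simp

/-- The value of the simple root `α_i` on a torus element. -/
noncomputable def rootVal (i : Fin n) (t : Fin n → ℂˣ) : ℂˣ := ∏ k, t k ^ cartan n k i

theorem torus_mul_ySub (i : Fin n) (t : Fin n → ℂˣ) (b : ℂ) :
    torus t * ySub i b = ySub i ((rootVal i t)⁻¹ * b) * torus t := by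
  apply Subtype.ext
  ext1
  rw [Subgroup.coe_mul, Subgroup.coe_mul, Units.val_mul, Units.val_mul, torus_val]
  simp only [ySub, expF_val, mul_add, add_mul, mul_one, one_mul, mul_smul_comm, smul_mul_assoc]
  congr 1
  refine matrix_ext_mulVec fun ψ a => ?_
  simp only [Matrix.smul_mulVec, ← Matrix.mulVec_mulVec, Pi.smul_apply, Matrix.mulVec_diagonal,
    fMat_mulVec_apply, smul_eq_mul]
  rcases h : raise i a with _ | d
  · simp
  · have h1 := hval_lower (raise_eq_some_iff.1 h)
    simp only [Option.elim_some, Matrix.mulVec_diagonal, h1, rootVal, zpow_sub,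
      Finset.prod_mul_distrib, Finset.prod_inv_distrib, Units.val_mul]
    push_cast
    ring

theorem torus_mul_xSub (i : Fin n) (t : Fin n → ℂˣ) (b : ℂ) :
    torus t * xSub i b = xSub i (rootVal i t * b) * torus t := by
  apply Subtype.ext
  ext1
  rw [Subgroup.coe_mul, Subgroup.coe_mul, Units.val_mul, Units.val_mul, torus_val]
  simp only [xSub, expE_val, mul_add, add_mul, mul_one, one_mul, mul_smul_comm, smul_mul_assoc]
  congr 1
  refine matrix_ext_mulVec fun ψ a => ?_
  simp only [Matrix.smul_mulVec, ← Matrix.mulVec_mulVec, Pi.smul_apply, Matrix.mulVec_diagonal,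
    eMat_mulVec_apply, smul_eq_mul]
  rcases h : lower i a with _ | d
  · simp
  · have h1 : ∀ k, hval k a = cartan n k i + hval k d := fun k => by rw [hval_lower h k]; ring
    simp only [Option.elim_some, Matrix.mulVec_diagonal, h1, rootVal, zpow_add,
      Finset.prod_mul_distrib, Units.val_mul]
    ring

theorem torus_conj_mem_Uminus (t : Fin n → ℂˣ) {u : G n} (hu : u ∈ Uminus n) :
    torus t * u * (torus t)⁻¹ ∈ Uminus n := by
  have : Uminus n ≤ (Uminus n).comap (MulAut.conj (torus t)).toMonoidHom := by
    conv_lhs => rw [Uminus]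
    rw [Subgroup.closure_le]
    rintro _ ⟨i, b, rfl⟩
    simp only [Subgroup.coe_comap, Set.mem_preimage, MulEquiv.coe_toMonoidHom, MulAut.conj_apply,
      torus_mul_ySub, mul_inv_cancel_right]
    exact ySub_mem _ _
  exact this hu

/-! The big cell. -/

/-- The big cell `U⁻ T U⁺`. -/
def bigCell (n : ℕ) : Set (G n) :=
  {g | ∃ u ∈ Uminus n, ∃ t, ∃ v ∈ Uplus n, g = u * torus t * v}

theorem eventually_one_add_mul_ne_zero (β : ℂ) : ∀ᶠ a in Filter.cofinite, 1 + a * β ≠ 0 := by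
  rw [Filter.eventually_cofinite]
  refine (Set.finite_singleton (-β⁻¹)).subset fun a ha => ?_
  simp only [not_not, Set.mem_ofPred_eq] at ha
  have hβ : β ≠ 0 := by rintro rfl; simp at ha
  rw [Set.mem_singleton_iff]
  field_simp
  linear_combination ha

theorem xSub_mul_Uminus (i : Fin n) {u : G n} (hu : u ∈ Uminus n) :
    ∃ β : ℂ, ∀ᶠ a in Filter.cofinite, 1 + a * β ≠ 0 ∧ ∃ u' ∈ Uminus n, ∃ t,
      xSub i a * u = u' * torus t * xSub i (a / (1 + a * β)) := by
  have step : ∀ u : G n, (∃ β : ℂ, ∀ᶠ a in Filter.cofinite, 1 + a * β ≠ 0 ∧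
      ∃ u' ∈ Uminus n, ∃ t, xSub i a * u = u' * torus t * xSub i (a / (1 + a * β))) →
      ∀ j b, ∃ β : ℂ, ∀ᶠ a in Filter.cofinite, 1 + a * β ≠ 0 ∧
      ∃ u' ∈ Uminus n, ∃ t, xSub i a * (u * ySub j b) =
        u' * torus t * xSub i (a / (1 + a * β)) := by
    rintro u ⟨β, h⟩ j b
    by_cases hij : i = j
    · subst hij
      refine ⟨β + b, ?_⟩
      filter_upwards [h, eventually_one_add_mul_ne_zero (β + b)] with a ⟨h1, u', hu', t, h2⟩ h3
      refine ⟨h3, ?_⟩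
      have h4 : 1 + a / (1 + a * β) * b = (1 + a * (β + b)) / (1 + a * β) := by
        field_simp; ring
      obtain ⟨w, hw⟩ : ∃ w : ℂˣ, (w : ℂ) = 1 + a / (1 + a * β) * b :=
        ⟨Units.mk0 _ (by rw [h4]; exact div_ne_zero h3 h1), rfl⟩
      refine ⟨u' * ySub i ((rootVal i t)⁻¹ * (b / w)), mul_mem hu' (ySub_mem _ _),
        t * Pi.mulSingle i w, ?_⟩
      rw [← mul_assoc, h2, mul_assoc, xSub_mul_ySub i _ b w hw, ← torus_mul, ← alphaCheck_eq_torus]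
      have h5 : a / (1 + a * β) / (w : ℂ) = a / (1 + a * (β + b)) := by
        rw [hw, h4, div_div_div_cancel_right₀ h1]
      rw [h5, mul_assoc u' (torus t), ← mul_assoc (torus t), ← mul_assoc (torus t),
        torus_mul_ySub]
      simp only [mul_assoc]
    · refine ⟨β, ?_⟩
      filter_upwards [h] with a ⟨h1, u', hu', t, h2⟩
      refine ⟨h1, u' * ySub j ((rootVal j t)⁻¹ * b), mul_mem hu' (ySub_mem _ _), t, ?_⟩
      rw [← mul_assoc, h2, mul_assoc, xSub_mul_ySub_of_ne hij, mul_assoc u' (torus t),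
        ← mul_assoc (torus t), torus_mul_ySub]
      simp only [mul_assoc]
  induction hu using Subgroup.closure_induction_right with
  | one =>
    exact ⟨0, Filter.Eventually.of_forall fun a => ⟨by simp, 1, one_mem _, 1, by simp [torus_one]⟩⟩
  | mul_right x hx y hy ih =>
    obtain ⟨j, b, rfl⟩ := hy
    exact step x ih j b
  | mul_inv_cancel x hx y hy ih =>
    obtain ⟨j, b, rfl⟩ := hy
    rw [ySub_inv]
    exact step x ih j (-b)

theorem xSub_mul_bigCell (i : Fin n) {g : G n} (hg : g ∈ bigCell n) :
    ∀ᶠ a in Filter.cofinite, xSub i a * g ∈ bigCell n := by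
  obtain ⟨u, hu, t, v, hv, rfl⟩ := hg
  obtain ⟨β, h⟩ := xSub_mul_Uminus i hu
  filter_upwards [h] with a ⟨_, u', hu', t', h2⟩
  refine ⟨u', hu', t' * t, xSub i ((rootVal i t)⁻¹ * (a / (1 + a * β))) * v,
    mul_mem (xSub_mem _ _) hv, ?_⟩
  have h3 : xSub i (a / (1 + a * β)) * torus t =
      torus t * xSub i ((rootVal i t)⁻¹ * (a / (1 + a * β))) := by
    rw [torus_mul_xSub]; simp
  rw [← mul_assoc, ← mul_assoc, h2, mul_assoc _ _ (torus t), h3, ← torus_mul]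
  simp only [mul_assoc]

theorem ySub_mul_bigCell (i : Fin n) (a : ℂ) {g : G n} (hg : g ∈ bigCell n) :
    ySub i a * g ∈ bigCell n := by
  obtain ⟨u, hu, t, v, hv, rfl⟩ := hg
  exact ⟨ySub i a * u, mul_mem (ySub_mem _ _) hu, t, v, hv, by simp only [mul_assoc]⟩

theorem torus_mul_bigCell (s : Fin n → ℂˣ) {g : G n} (hg : g ∈ bigCell n) :
    torus s * g ∈ bigCell n := by
  obtain ⟨u, hu, t, v, hv, rfl⟩ := hg
  refine ⟨torus s * u * (torus s)⁻¹, torus_conj_mem_Uminus s hu, s * t, v, hv, ?_⟩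
  rw [← torus_mul]
  simp only [mul_assoc, inv_mul_cancel_left]

theorem one_mem_bigCell : (1 : G n) ∈ bigCell n :=
  ⟨1, one_mem _, 1, 1, one_mem _, by simp [torus_one]⟩

/-- The value at `g` of a polynomial in the matrix entries. -/
noncomputable def evalPoly (p : MvPolynomial (Spin n × Spin n) ℂ) (g : G n) : ℂ :=
  MvPolynomial.eval (fun ab => (g : Matrix.GeneralLinearGroup (Spin n) ℂ) ab.1 ab.2) p

theorem exists_evalPoly_mul_left (p : MvPolynomial (Spin n × Spin n) ℂ) (h : G n) :
    ∃ q : MvPolynomial (Spin n × Spin n) ℂ, ∀ g, evalPoly q g = evalPoly p (h * g) := by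
  refine ⟨MvPolynomial.bind₁ (fun ab => ∑ k, MvPolynomial.C
    ((h : Matrix.GeneralLinearGroup (Spin n) ℂ) ab.1 k) * MvPolynomial.X (k, ab.2)) p, fun g => ?_⟩
  unfold evalPoly
  rw [MvPolynomial.eval, MvPolynomial.eval₂Hom_bind₁]
  congr 1
  congr 1
  funext ab
  simp [Matrix.mul_apply]

theorem exists_polynomial_eval_xSub (p : MvPolynomial (Spin n × Spin n) ℂ) (i : Fin n) (g : G n) :
    ∃ q : Polynomial ℂ, ∀ a, q.eval a = evalPoly p (xSub i a * g) := by
  refine ⟨MvPolynomial.aeval (fun ab => Polynomial.C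
      ((g : Matrix.GeneralLinearGroup (Spin n) ℂ) ab.1 ab.2) + Polynomial.X * Polynomial.C
      ((eMat i * (g : Matrix.GeneralLinearGroup (Spin n) ℂ).val) ab.1 ab.2)) p, fun a => ?_⟩
  unfold evalPoly
  rw [← Polynomial.coe_evalRingHom, MvPolynomial.aeval_def, MvPolynomial.hom_eval₂,
    MvPolynomial.eval, MvPolynomial.coe_eval₂Hom]
  congr 1
  · ext; simp
  · funext ab
    simp [xSub, expE_val, add_mul, mul_comm a]

theorem evalPoly_xSub_mul {p : MvPolynomial (Spin n × Spin n) ℂ}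
    (hp : ∀ g ∈ bigCell n, evalPoly p g = 0) (i : Fin n) (a : ℂ) {g : G n} (hg : g ∈ bigCell n) :
    evalPoly p (xSub i a * g) = 0 := by
  obtain ⟨q, hq⟩ := exists_polynomial_eval_xSub p i g
  have : q = 0 := by
    refine Polynomial.eq_zero_of_infinite_isRoot q ?_
    have h1 := xSub_mul_bigCell i hg
    rw [Filter.eventually_cofinite] at h1
    refine h1.infinite_compl.mono fun b hb => ?_
    simp only [Set.mem_compl_iff, Set.mem_ofPred_eq, not_not] at hb
    simp [Polynomial.IsRoot, hq, hp _ hb]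
  rw [← hq, this, Polynomial.eval_zero]

theorem evalPoly_eq_zero {p : MvPolynomial (Spin n × Spin n) ℂ}
    (hp : ∀ g ∈ bigCell n, evalPoly p g = 0) (g : G n) : evalPoly p g = 0 := by
  have key : ∀ g : G n, ∀ p : MvPolynomial (Spin n × Spin n) ℂ,
      (∀ h ∈ bigCell n, evalPoly p h = 0) → ∀ h ∈ bigCell n, evalPoly p (g * h) = 0 := by
    rintro ⟨g, hg⟩
    have gen : ∀ x (hx : x ∈ G n), x ∈ ({g | ∃ (i : Fin n) (t : ℂ), g = expE i t} ∪
        {g | ∃ (i : Fin n) (t : ℂ), g = expF i t} ∪ {g | ∃ (i : Fin n) (c : ℂˣ), g = powH i c}) →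
        ∀ p : MvPolynomial (Spin n × Spin n) ℂ, (∀ h ∈ bigCell n, evalPoly p h = 0) →
        ∀ h ∈ bigCell n, evalPoly p (⟨x, hx⟩ * h) = 0 := by
      rintro x hx ((⟨i, t, rfl⟩ | ⟨i, t, rfl⟩) | ⟨i, c, rfl⟩) p hp h hh
      · exact evalPoly_xSub_mul hp i t hh
      · exact hp _ (ySub_mul_bigCell i t hh)
      · refine hp _ ?_
        have := torus_mul_bigCell (Pi.mulSingle i c) hh
        rwa [← alphaCheck_eq_torus] at this
    have trans : ∀ x y : G n, (∀ p : MvPolynomial (Spin n × Spin n) ℂ,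
        (∀ h ∈ bigCell n, evalPoly p h = 0) → ∀ h ∈ bigCell n, evalPoly p (x * h) = 0) →
        (∀ p : MvPolynomial (Spin n × Spin n) ℂ,
        (∀ h ∈ bigCell n, evalPoly p h = 0) → ∀ h ∈ bigCell n, evalPoly p (y * h) = 0) →
        (∀ p : MvPolynomial (Spin n × Spin n) ℂ,
        (∀ h ∈ bigCell n, evalPoly p h = 0) → ∀ h ∈ bigCell n, evalPoly p (x * y * h) = 0) := by
      intro x y hx hy p hp h hh
      obtain ⟨q, hq⟩ := exists_evalPoly_mul_left p x
      rw [mul_assoc, ← hq]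
      exact hy q (fun k hk => by rw [hq]; exact hx p hp k hk) h hh
    induction hg using Subgroup.closure_induction_right with
    | one => intro p hp h hh; exact hp _ (by convert hh; exact one_mul h)
    | mul_right x hx y hy ih =>
      exact trans ⟨x, hx⟩ ⟨y, Subgroup.subset_closure hy⟩ ih (gen y _ hy)
    | mul_inv_cancel x hx y hy ih =>
      have hy' : y⁻¹ ∈ ({g | ∃ (i : Fin n) (t : ℂ), g = expE i t} ∪
        {g | ∃ (i : Fin n) (t : ℂ), g = expF i t} ∪
          {g | ∃ (i : Fin n) (c : ℂˣ), g = powH i c}) := by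
        rcases hy with (⟨i, t, rfl⟩ | ⟨i, t, rfl⟩) | ⟨i, c, rfl⟩
        · exact Or.inl (Or.inl ⟨i, -t, expE_neg i t⟩)
        · exact Or.inl (Or.inr ⟨i, -t, expF_neg i t⟩)
        · refine Or.inr ⟨i, c⁻¹, ?_⟩
          rw [inv_eq_iff_mul_eq_one]
          ext1
          simp only [powH, Units.val_mul, Matrix.diagonal_mul_diagonal, Units.val_one,
            ← Matrix.diagonal_one]
          congr 1
          funext ε
          rw [← Units.val_mul, ← mul_zpow, mul_inv_cancel, one_zpow, Units.val_one]
      exact trans ⟨x, hx⟩ ⟨y⁻¹, Subgroup.subset_closure hy'⟩ ih (gen y⁻¹ _ hy')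
  simpa using key g p hp 1 one_mem_bigCell

theorem IsPrincipalMinor.unique {μ : Weight n} {D D' : G n → ℂ} (h : IsPrincipalMinor μ D)
    (h' : IsPrincipalMinor μ D') : D = D' := by
  obtain ⟨⟨p, hp⟩, h1⟩ := h
  obtain ⟨⟨q, hq⟩, h2⟩ := h'
  funext g
  have : evalPoly (p - q) g = 0 := by
    refine evalPoly_eq_zero ?_ g
    rintro _ ⟨u, hu, t, v, hv, rfl⟩
    rw [evalPoly, map_sub, ← hp, ← hq, h1 u hu v hv t, h2 u hu v hv t, sub_self]
  rwa [evalPoly, map_sub, ← hp, ← hq, sub_eq_zero] at this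

/-! The highest weight vector. -/

/-- The highest weight vector of the spin representation. -/
def topSpin (n : ℕ) : Spin n := fun _ => true

theorem raise_topSpin (i : Fin n) : raise i (topSpin n) = none := by
  rcases h : raise i (topSpin n) with _ | b
  · rfl
  · simpa [topSpin] using (raise_eq_some_iff'.1 h).1

theorem hval_topSpin (hn : 1 ≤ n) (i : Fin n) :
    hval i (topSpin n) = fundWeight (lastIdx n hn) i := by
  have := i.2
  unfold hval topSpin fundWeight lastIdx
  by_cases h : (i : ℕ) + 1 < n
  · simp [h, Pi.single_apply, Fin.ext_iff]; omega
  · simp [h, Pi.single_apply, Fin.ext_iff]; omega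

theorem Uplus_mulVec_top {v : G n} (hv : v ∈ Uplus n) :
    (v : Matrix.GeneralLinearGroup (Spin n) ℂ).val.mulVec (Pi.single (topSpin n) 1) =
      Pi.single (topSpin n) 1 := by
  have step : ∀ (i : Fin n) a, (xSub i a : Matrix.GeneralLinearGroup (Spin n) ℂ).val.mulVec
      (Pi.single (topSpin n) 1) = Pi.single (topSpin n) 1 := by
    intro i a
    simp only [xSub, expE_val, Matrix.add_mulVec, Matrix.one_mulVec, Matrix.smul_mulVec]
    ext b
    simp only [Pi.add_apply, Pi.smul_apply, eMat_mulVec_apply]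
    rcases h : lower i b with _ | c
    · simp
    · have : c ≠ topSpin n := by
        rintro rfl
        have := raise_topSpin i
        simp [raise_eq_some_iff.2 h] at this
      simp [this]
  induction hv using Subgroup.closure_induction_right with
  | one => rw [Subgroup.coe_one, Units.val_one, Matrix.one_mulVec]
  | mul_right x hx y hy ih =>
    obtain ⟨j, b, rfl⟩ := hy
    rw [Subgroup.coe_mul, Units.val_mul, ← Matrix.mulVec_mulVec, step, ih]
  | mul_inv_cancel x hx y hy ih =>
    obtain ⟨j, b, rfl⟩ := hy
    rw [Subgroup.coe_mul, Units.val_mul, ← Matrix.mulVec_mulVec, xSub_inv, step, ih]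

theorem Uminus_vecMul_top {v : G n} (hv : v ∈ Uminus n) :
    Matrix.vecMul (Pi.single (topSpin n) 1) (v : Matrix.GeneralLinearGroup (Spin n) ℂ).val =
      Pi.single (topSpin n) 1 := by
  have step : ∀ (i : Fin n) a, Matrix.vecMul (Pi.single (topSpin n) 1)
      (ySub i a : Matrix.GeneralLinearGroup (Spin n) ℂ).val = Pi.single (topSpin n) 1 := by
    intro i a
    have := Uplus_mulVec_top (xSub_mem (n := n) i a)
    rw [← Matrix.vecMul_transpose] at this
    have e : (ySub i a : Matrix.GeneralLinearGroup (Spin n) ℂ).val =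
        (xSub i a : Matrix.GeneralLinearGroup (Spin n) ℂ).val.transpose := by
      simp only [ySub, xSub, expE_val, expF_val, Matrix.transpose_add, Matrix.transpose_one,
        Matrix.transpose_smul, eMat_transpose]
    rw [e, this]
  induction hv using Subgroup.closure_induction_right with
  | one => rw [Subgroup.coe_one, Units.val_one, Matrix.vecMul_one]
  | mul_right x hx y hy ih =>
    obtain ⟨j, b, rfl⟩ := hy
    rw [Subgroup.coe_mul, Units.val_mul, ← Matrix.vecMul_vecMul, ih, step]
  | mul_inv_cancel x hx y hy ih =>
    obtain ⟨j, b, rfl⟩ := hy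
    rw [Subgroup.coe_mul, Units.val_mul, ← Matrix.vecMul_vecMul, ih, ySub_inv, step]

/-- The matrix entry of `g` at the highest weight vector. -/
def topEntry (g : G n) : ℂ :=
  (g : Matrix.GeneralLinearGroup (Spin n) ℂ) (topSpin n) (topSpin n)

theorem isPrincipalMinor_topEntry (hn : 1 ≤ n) :
    IsPrincipalMinor (fundWeight (lastIdx n hn)) (topEntry (n := n)) := by
  refine ⟨⟨MvPolynomial.X (topSpin n, topSpin n), fun g => by simp [topEntry]⟩,
    fun u hu v hv t => ?_⟩
  have h : ∀ M : Matrix (Spin n) (Spin n) ℂ, M (topSpin n) (topSpin n) =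
      dotProduct (Pi.single (topSpin n) 1) (M.mulVec (Pi.single (topSpin n) 1)) := by
    intro M; simp
  refine (h ((u * torus t * v : G n) : Matrix.GeneralLinearGroup (Spin n) ℂ).val).trans ?_
  rw [Subgroup.coe_mul, Subgroup.coe_mul, Units.val_mul, Units.val_mul, ← Matrix.mulVec_mulVec,
    Uplus_mulVec_top hv, ← Matrix.mulVec_mulVec, Matrix.dotProduct_mulVec, Uminus_vecMul_top hu,
    torus_val]
  simp [hval_topSpin hn]

/-! The representatives of the simple reflections. -/

/-- The matrix of an element of `G`. -/
abbrev mat (g : G n) : Matrix (Spin n) (Spin n) ℂ := (g : Matrix.GeneralLinearGroup (Spin n) ℂ).val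

theorem mat_mul (g h : G n) : mat (g * h) = mat g * mat h := rfl

theorem mat_one : mat (1 : G n) = 1 := rfl

theorem mat_xSub (i : Fin n) (t : ℂ) : mat (xSub i t) = 1 + t • eMat i := expE_val i t

theorem mat_ySub (i : Fin n) (t : ℂ) : mat (ySub i t) = 1 + t • fMat i := expF_val i t

theorem mat_x_y_x (i : Fin n) (t : ℂ) (ht : t * t = 1) :
    mat (xSub i t * ySub i (-t) * xSub i t) =
      1 + t • eMat i - t • fMat i - eMat i * fMat i - fMat i * eMat i := by
  have h2 := eMat_mul_self i
  have h3 := eMat_mul_fMat_mul_eMat i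
  rw [mat_mul, mat_mul, mat_xSub, mat_ySub]
  have h4 : ∀ M : Matrix (Spin n) (Spin n) ℂ, t • t • M = M := fun M => by
    rw [smul_smul, ht, one_smul]
  simp only [mul_add, add_mul, mul_one, one_mul, smul_mul_assoc, mul_smul_comm, smul_add,
    h2, h3, smul_zero, neg_smul, smul_neg, mul_neg, neg_mul, h4]
  abel

theorem mat_sbar (i : Fin n) :
    mat (sbar i) = 1 - eMat i + fMat i - eMat i * fMat i - fMat i * eMat i := by
  have := mat_x_y_x i (-1) (by norm_num)
  rw [neg_neg] at this
  rw [sbar, this]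
  module

theorem mat_sbar_inv_transpose (i : Fin n) : (mat (sbar i)⁻¹).transpose = mat (sbar i) := by
  have : (sbar i)⁻¹ = xSub i 1 * ySub i (-1) * xSub i 1 := by
    rw [sbar, mul_inv_rev, mul_inv_rev, xSub_inv, ySub_inv, neg_neg, mul_assoc]
  rw [this, mat_x_y_x i 1 (by norm_num), mat_sbar]
  simp only [Matrix.transpose_sub, Matrix.transpose_add, Matrix.transpose_smul,
    Matrix.transpose_mul, Matrix.transpose_one, eMat_transpose, fMat_transpose]
  module

theorem mat_wordLift_inv_transpose (a : List (Fin n)) :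
    (mat (wordLift a)⁻¹).transpose = mat (wordLift a) := by
  induction a with
  | nil => rw [wordLift, List.map_nil, List.prod_nil, inv_one, mat_one, Matrix.transpose_one]
  | cons i a ih =>
    have h : wordLift (i :: a) = sbar i * wordLift a := by simp [wordLift]
    rw [h, mul_inv_rev, mat_mul, Matrix.transpose_mul, ih, mat_sbar_inv_transpose, mat_mul]

theorem fMat_mulVec_single (i : Fin n) (a : Spin n) :
    (fMat i).mulVec (Pi.single a 1) = (lower i a).elim 0 fun b => Pi.single b 1 := by
  ext c
  rw [fMat_mulVec_apply]
  rcases h : raise i c with _ | d <;> rcases h' : lower i a with _ | b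
  · rfl
  · have : c ≠ b := by rintro rfl; simp [raise_eq_some_iff.2 h'] at h
    simp [this]
  · have : d ≠ a := by rintro rfl; simp [raise_eq_some_iff.1 h] at h'
    simp [this]
  · have := raise_eq_some_iff.1 h
    by_cases hd : d = a
    · subst hd
      rw [this] at h'
      cases h'
      simp
    · have : c ≠ b := by
        rintro rfl
        rw [raise_eq_some_iff.2 h'] at h
        cases h
        exact hd rfl
      simp [hd, this]

theorem eMat_mulVec_single (i : Fin n) (a : Spin n) :
    (eMat i).mulVec (Pi.single a 1) = (raise i a).elim 0 fun b => Pi.single b 1 := by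
  ext c
  rw [eMat_mulVec_apply]
  rcases h : lower i c with _ | d <;> rcases h' : raise i a with _ | b
  · rfl
  · have : c ≠ b := by rintro rfl; simp [raise_eq_some_iff.1 h'] at h
    simp [this]
  · have : d ≠ a := by rintro rfl; simp [raise_eq_some_iff.2 h] at h'
    simp [this]
  · have := raise_eq_some_iff.2 h
    by_cases hd : d = a
    · subst hd
      rw [this] at h'
      cases h'
      simp
    · have : c ≠ b := by
        rintro rfl
        rw [raise_eq_some_iff.1 h'] at h
        cases h
        exact hd rfl
      simp [hd, this]

theorem sbar_mulVec_of_lower {i : Fin n} {a b : Spin n} (h : lower i a = some b) :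
    (mat (sbar i)).mulVec (Pi.single a 1) = Pi.single b 1 := by
  have h1 : raise i a = none := by
    rcases h' : raise i a with _ | d
    · rfl
    · have h2 := (hval_of_lower (raise_eq_some_iff.1 h')).2
      rw [(hval_of_lower h).1] at h2
      norm_num at h2
  rw [mat_sbar]
  simp only [Matrix.sub_mulVec, Matrix.add_mulVec, Matrix.one_mulVec, ← Matrix.mulVec_mulVec]
  rw [fMat_mulVec_single, eMat_mulVec_single, h, h1]
  simp only [Option.elim_none, Option.elim_some, Matrix.mulVec_zero]
  rw [eMat_mulVec_single, raise_eq_some_iff.2 h]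
  simp

theorem sbar_mulVec_of_none {i : Fin n} {a : Spin n} (h : lower i a = none)
    (h' : raise i a = none) : (mat (sbar i)).mulVec (Pi.single a 1) = Pi.single a 1 := by
  rw [mat_sbar]
  simp only [Matrix.sub_mulVec, Matrix.add_mulVec, Matrix.one_mulVec, ← Matrix.mulVec_mulVec]
  rw [fMat_mulVec_single, eMat_mulVec_single, h, h']
  simp

/-! Orthogonal coordinates on the weight lattice. -/

/-- Twice the coordinates of a weight in the orthonormal basis. -/
def coord (wt : Weight n) (a : Fin n) : ℤ :=
  ∑ k ∈ Finset.univ.filter (a ≤ ·), (if (k : ℕ) + 1 = n then 1 else 2) * wt k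

theorem coord_of_not_lt {a : Fin n} (h : ¬ (a : ℕ) + 1 < n) (wt : Weight n) :
    coord wt a = wt a := by
  have ha := a.2
  have : Finset.univ.filter (a ≤ ·) = {a} := by
    ext k
    have := k.2
    simp only [Finset.mem_filter, Finset.mem_univ, true_and, Finset.mem_singleton, Fin.ext_iff,
      Fin.le_def]
    omega
  rw [coord, this, Finset.sum_singleton, if_pos (by omega), one_mul]

theorem coord_of_lt {a : Fin n} (h : (a : ℕ) + 1 < n) (wt : Weight n) :
    2 * wt a = coord wt a - coord wt ⟨a + 1, h⟩ := by
  have : Finset.univ.filter (a ≤ ·) =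
      insert a (Finset.univ.filter ((⟨a + 1, h⟩ : Fin n) ≤ ·)) := by
    ext k
    simp only [Finset.mem_filter, Finset.mem_univ, true_and, Finset.mem_insert, Fin.ext_iff,
      Fin.le_def]
    omega
  rw [coord, coord, this, Finset.sum_insert (by simp [Fin.le_def]), if_neg (by omega)]
  ring

theorem coord_unique {wt : Weight n} {y : Fin n → ℤ}
    (h : ∀ (a : Fin n) (ha : (a : ℕ) + 1 < n), 2 * wt a = y a - y ⟨a + 1, ha⟩)
    (h' : ∀ a : Fin n, ¬ (a : ℕ) + 1 < n → y a = wt a) : coord wt = y := by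
  have key : ∀ m : ℕ, ∀ a : Fin n, (a : ℕ) + m + 1 = n → coord wt a = y a := by
    intro m
    induction m with
    | zero => intro a ha; rw [coord_of_not_lt (by omega), h' a (by omega)]
    | succ m ih =>
      intro a ha
      have h1 := h a (by omega)
      have h2 := coord_of_lt (a := a) (by omega) wt
      have h3 := ih ⟨a + 1, by omega⟩ (by simp only; omega)
      omega
  funext a
  exact key (n - 1 - a) a (by have := a.2; omega)

theorem coord_injective : Function.Injective (coord (n := n)) := by
  intro v w h
  funext a
  by_cases ha : (a : ℕ) + 1 < n
  · have h1 := coord_of_lt ha v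
    have h2 := coord_of_lt ha w
    rw [h] at h1
    omega
  · rw [← coord_of_not_lt ha v, ← coord_of_not_lt ha w, h]

theorem coord_simpleReflection (i : Fin n) (wt : Weight n) (a : Fin n) :
    coord (simpleReflection i wt) a = coord wt a -
      wt i * (if a = i then 2 else if (a : ℕ) = i + 1 then -2 else 0) := by
  have hi := i.2
  have hs : ∀ k, simpleReflection i wt k = wt k - wt i * cartan n k i := fun k => rfl
  refine congrFun (coord_unique
    (y := fun a => coord wt a -
      wt i * (if a = i then 2 else if (a : ℕ) = i + 1 then -2 else 0)) ?_ ?_) a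
  · intro a ha
    have h1 := coord_of_lt ha wt
    rw [hs, mul_sub, h1]
    have : 2 * cartan n a i = (if a = i then 2 else if (a : ℕ) = i + 1 then -2 else 0) -
        (if (⟨a + 1, ha⟩ : Fin n) = i then 2 else if (a : ℕ) + 1 = i + 1 then -2 else 0) := by
      unfold cartan
      simp only [Fin.ext_iff]
      split_ifs <;> omega
    linear_combination (- wt i) * this
  · intro a ha
    have han := a.2
    rw [hs, coord_of_not_lt ha]
    congr 2
    unfold cartan
    simp only [Fin.ext_iff]
    split_ifs <;> omega

theorem coord_simpleReflection_of_lt {i : Fin n} (h : (i : ℕ) + 1 < n) (wt : Weight n)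
    (a : Fin n) : coord (simpleReflection i wt) a = coord wt (Equiv.swap i ⟨i + 1, h⟩ a) := by
  have h1 := coord_of_lt h wt
  rw [coord_simpleReflection]
  by_cases ha : a = i
  · subst ha
    rw [if_pos rfl, Equiv.swap_apply_left]
    linarith
  by_cases ha' : a = ⟨i + 1, h⟩
  · subst ha'
    rw [if_neg ha, if_pos rfl, Equiv.swap_apply_right]
    linarith
  · rw [Equiv.swap_apply_of_ne_of_ne ha ha', if_neg ha, if_neg fun h' => ha' (Fin.ext h')]
    ring

theorem coord_simpleReflection_of_not_lt {i : Fin n} (h : ¬ (i : ℕ) + 1 < n) (wt : Weight n)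
    (a : Fin n) : coord (simpleReflection i wt) a = (if a = i then -1 else 1) * coord wt a := by
  have ha := a.2
  rw [coord_simpleReflection]
  split_ifs with h1 h2
  · subst h1; rw [coord_of_not_lt h]; ring
  · omega
  · ring

/-- `w` acts on the orthogonal coordinates by a signed permutation. -/
def IsSignedPerm (w : Equiv.Perm (Weight n)) (σ : Equiv.Perm (Fin n)) (η : Fin n → ℤ) : Prop :=
  (∀ a, η a = 1 ∨ η a = -1) ∧ ∀ wt a, coord (w wt) a = η a * coord wt (σ a)

theorem exists_isSignedPerm_simpleReflection (i : Fin n) :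
    ∃ σ η, IsSignedPerm (simpleReflection i) σ η := by
  by_cases h : (i : ℕ) + 1 < n
  · exact ⟨Equiv.swap i ⟨i + 1, h⟩, 1, fun _ => Or.inl rfl, fun wt a => by
      rw [coord_simpleReflection_of_lt h]; simp⟩
  · refine ⟨1, fun a => if a = i then -1 else 1, fun a => ?_, fun wt a => ?_⟩
    · dsimp only; split_ifs <;> simp
    · rw [coord_simpleReflection_of_not_lt h]; simp

theorem IsSignedPerm.mul {w w' : Equiv.Perm (Weight n)} {σ σ' η η'} (h : IsSignedPerm w σ η)
    (h' : IsSignedPerm w' σ' η') :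
    IsSignedPerm (w * w') (σ' * σ) (fun a => η a * η' (σ a)) := by
  refine ⟨fun a => ?_, fun wt a => ?_⟩
  · rcases h.1 a with h1 | h1 <;> rcases h'.1 (σ a) with h2 | h2 <;> simp [h1, h2]
  · rw [Equiv.Perm.mul_apply, h.2, h'.2]; simp [mul_assoc]

theorem wordProd_cons (i : Fin n) (a : List (Fin n)) :
    wordProd (i :: a) = simpleReflection i * wordProd a := by simp [wordProd]

theorem wordProd_append (a b : List (Fin n)) :
    wordProd (a ++ b) = wordProd a * wordProd b := by simp [wordProd]

theorem wordProd_singleton (i : Fin n) : wordProd [i] = simpleReflection i := by simp [wordProd]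

theorem exists_isSignedPerm_wordProd (a : List (Fin n)) :
    ∃ σ η, IsSignedPerm (wordProd a) σ η := by
  induction a with
  | nil => exact ⟨1, 1, fun _ => Or.inl rfl, fun wt a => by simp [wordProd]⟩
  | cons i a ih =>
    obtain ⟨σ, η, h⟩ := ih
    obtain ⟨σ', η', h'⟩ := exists_isSignedPerm_simpleReflection i
    rw [wordProd_cons]
    exact ⟨_, _, h'.mul h⟩

theorem simpleReflection_mul_self (i : Fin n) :
    (simpleReflection i : Equiv.Perm (Weight n)) * simpleReflection i = 1 :=
  Equiv.ext fun wt => reflection_involutive i wt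

/-- The sum of the fundamental weights. -/
def rho : Weight n := fun _ => 1

theorem coord_rho (a : Fin n) : coord (rho : Weight n) a = 2 * ((n : ℤ) - a) - 1 := by
  refine congrFun (coord_unique (y := fun a : Fin n => 2 * ((n : ℤ) - a) - 1) ?_ ?_) a
  · intro a ha; simp [rho]; ring
  · intro a ha; have := a.2; simp only [rho]; omega

theorem coord_simpleReflection_rho (i a : Fin n) : coord (simpleReflection i rho) a =
    2 * ((n : ℤ) - a) - 1 - (if a = i then 2 else if (a : ℕ) = i + 1 then -2 else 0) := by
  rw [coord_simpleReflection, coord_rho, rho, one_mul]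

theorem simpleReflection_mul_eq {w : Equiv.Perm (Weight n)} {σ η} (hw : IsSignedPerm w σ η)
    {i j : Fin n} (h1 : 0 ≤ w rho i) (h2 : w (simpleReflection j rho) i < 0) :
    simpleReflection i * w = w * simpleReflection j := by
  have hj := j.2
  by_cases hi : (i : ℕ) + 1 < n
  · have e1 := coord_of_lt hi (w rho)
    have e2 := coord_of_lt hi (w (simpleReflection j rho))
    rw [hw.2, hw.2, coord_rho, coord_rho] at e1
    rw [hw.2, hw.2, coord_simpleReflection_rho, coord_simpleReflection_rho] at e2
    set i' : Fin n := ⟨i + 1, hi⟩ with hi'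
    have hne : ((σ i : Fin n) : ℕ) ≠ σ i' := by
      intro h
      have := σ.injective (Fin.ext h)
      simp [hi', Fin.ext_iff] at this
    have b1 := (σ i).2
    have b2 := (σ i').2
    simp only [Fin.ext_iff] at e2
    have key : η i = η i' ∧ ((j : ℕ) + 1 < n) ∧
        (((σ i : Fin n) : ℕ) = j ∧ ((σ i' : Fin n) : ℕ) = j + 1 ∨
        ((σ i : Fin n) : ℕ) = j + 1 ∧ ((σ i' : Fin n) : ℕ) = j) := by
      rcases hw.1 i with s1 | s1 <;> rcases hw.1 i' with s2 | s2 <;> rw [s1, s2] at e1 e2 ⊢ <;>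
        split_ifs at e2 <;> omega
    obtain ⟨k1, k2, k3⟩ := key
    have hsw : Equiv.swap j ⟨j + 1, k2⟩ = Equiv.swap (σ i) (σ i') := by
      rcases k3 with ⟨k3, k4⟩ | ⟨k3, k4⟩
      · congr 1 <;> ext <;> simp [k3, k4]
      · rw [Equiv.swap_comm]; congr 1 <;> ext <;> simp [k3, k4]
    refine Equiv.ext fun wt => coord_injective (funext fun a => ?_)
    rw [Equiv.Perm.mul_apply, Equiv.Perm.mul_apply, coord_simpleReflection_of_lt hi, hw.2, hw.2,
      coord_simpleReflection_of_lt k2, hsw, σ.injective.swap_apply]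
    congr 1
    by_cases ha : a = i
    · subst ha; rw [Equiv.swap_apply_left, k1]
    by_cases ha' : a = i'
    · subst ha'; rw [Equiv.swap_apply_right, k1]
    · rw [Equiv.swap_apply_of_ne_of_ne ha ha']
  · have hin := i.2
    have e1 := coord_of_not_lt hi (w rho)
    have e2 := coord_of_not_lt hi (w (simpleReflection j rho))
    rw [hw.2, coord_rho] at e1
    rw [hw.2, coord_simpleReflection_rho] at e2
    have b1 := (σ i).2
    simp only [Fin.ext_iff] at e2
    have key : (j : ℕ) = i ∧ ((σ i : Fin n) : ℕ) = i := by
      rcases hw.1 i with s1 | s1 <;> rw [s1] at e1 e2 <;> split_ifs at e2 <;> omega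
    obtain rfl : j = i := Fin.ext key.1
    have hσ : σ j = j := Fin.ext key.2
    refine Equiv.ext fun wt => coord_injective (funext fun a => ?_)
    rw [Equiv.Perm.mul_apply, Equiv.Perm.mul_apply, coord_simpleReflection_of_not_lt hi, hw.2, hw.2,
      coord_simpleReflection_of_not_lt hi]
    have : σ a = j ↔ a = j := by rw [← hσ, σ.injective.eq_iff, hσ]
    simp only [this]
    ring

/-- The exchange property. -/
theorem exists_shorter_word (a : List (Fin n)) (i : Fin n) (h : wordProd a rho i < 0) :
    ∃ b : List (Fin n), b.length + 1 = a.length ∧ wordProd (i :: a) = wordProd b := by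
  induction a using List.reverseRecOn with
  | nil => simp [wordProd, rho] at h
  | append_singleton v j ih =>
    by_cases hv : wordProd v rho i < 0
    · obtain ⟨b, hb, hb'⟩ := ih hv
      refine ⟨b ++ [j], by simp [hb], ?_⟩
      rw [wordProd_append, ← hb', ← wordProd_append, List.cons_append]
    · obtain ⟨σ, η, hw⟩ := exists_isSignedPerm_wordProd v
      rw [wordProd_append, wordProd_singleton, Equiv.Perm.mul_apply] at h
      refine ⟨v, by simp, ?_⟩
      rw [wordProd_cons, wordProd_append, wordProd_singleton, ← mul_assoc,
        simpleReflection_mul_eq hw (not_lt.1 hv) h, mul_assoc, simpleReflection_mul_self, mul_one]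

theorem weylLength_wordProd_le (a : List (Fin n)) : weylLength (wordProd a) ≤ a.length :=
  Nat.sInf_le ⟨a, rfl, rfl⟩

theorem exists_wordProd_eq {w : Equiv.Perm (Weight n)} (hw : w ∈ weylGroup n) :
    ∃ a, wordProd a = w := by
  induction hw using Subgroup.closure_induction_right with
  | one => exact ⟨[], rfl⟩
  | mul_right x hx y hy ih =>
    obtain ⟨i, rfl⟩ := hy
    obtain ⟨a, rfl⟩ := ih
    exact ⟨a ++ [i], by rw [wordProd_append, wordProd_singleton]⟩
  | mul_inv_cancel x hx y hy ih =>
    obtain ⟨i, rfl⟩ := hy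
    obtain ⟨a, rfl⟩ := ih
    exact ⟨a ++ [i], by
      rw [wordProd_append, wordProd_singleton, eq_comm, mul_inv_eq_iff_eq_mul, mul_assoc,
        simpleReflection_mul_self, mul_one]⟩

theorem exists_isReducedWord {w : Equiv.Perm (Weight n)} (hw : w ∈ weylGroup n) :
    ∃ a, IsReducedWord a ∧ wordProd a = w := by
  obtain ⟨a, ha⟩ := exists_wordProd_eq hw
  obtain ⟨b, hb, hb'⟩ :=
    Nat.sInf_mem (s := {k | ∃ a : List (Fin n), a.length = k ∧ wordProd a = w}) ⟨_, a, rfl, ha⟩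
  exact ⟨b, by rw [IsReducedWord, hb', hb, weylLength], hb'⟩

theorem simpleReflection_mem (i : Fin n) : simpleReflection i ∈ weylGroup n :=
  Subgroup.subset_closure ⟨i, rfl⟩

theorem wordProd_mem (a : List (Fin n)) : wordProd a ∈ weylGroup n :=
  list_prod_mem fun x hx => by
    obtain ⟨i, -, rfl⟩ := List.mem_map.1 hx
    exact simpleReflection_mem i

theorem IsReducedWord.of_cons {i : Fin n} {a : List (Fin n)} (h : IsReducedWord (i :: a)) :
    IsReducedWord a := by
  obtain ⟨b, hb, hb'⟩ := exists_isReducedWord (wordProd_mem a)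
  have h1 := weylLength_wordProd_le a
  have h2 := weylLength_wordProd_le (i :: b)
  rw [IsReducedWord] at *
  rw [wordProd_cons, hb', ← wordProd_cons, h, List.length_cons, List.length_cons] at h2
  rw [hb'] at hb
  omega

theorem IsReducedWord.rho_nonneg {i : Fin n} {a : List (Fin n)} (h : IsReducedWord (i :: a)) :
    0 ≤ wordProd a rho i := by
  by_contra! h'
  obtain ⟨b, hb, hb'⟩ := exists_shorter_word a i h'
  have := weylLength_wordProd_le b
  rw [← hb', h, List.length_cons] at this
  omega

/-! Spin weights. -/

/-- The weight of a basis vector. -/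
def spinWeight (a : Spin n) : Weight n := fun i => hval i a

theorem coord_spinWeight (a : Spin n) (k : Fin n) : coord (spinWeight a) k = sgn (a k) := by
  refine congrFun (coord_unique (y := fun k => sgn (a k)) ?_ ?_) k
  · intro k hk; exact two_mul_hval_of_lt hk a
  · intro k hk; exact (hval_of_not_lt hk a).symm

theorem spinWeight_injective : Function.Injective (spinWeight (n := n)) := by
  intro a b h
  funext k
  have := coord_spinWeight a k
  rw [h, coord_spinWeight] at this
  revert this
  unfold sgn
  cases a k <;> cases b k <;> simp

theorem simpleReflection_spinWeight_of_lower {i : Fin n} {a b : Spin n} (h : lower i a = some b) :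
    simpleReflection i (spinWeight a) = spinWeight b := by
  funext k
  change hval k a - hval i a * cartan n k i = hval k b
  rw [hval_lower h k, (hval_of_lower h).1, one_mul]

theorem simpleReflection_spinWeight_of_none {i : Fin n} {a : Spin n} (h : lower i a = none)
    (h' : raise i a = none) : simpleReflection i (spinWeight a) = spinWeight a := by
  funext k
  change hval k a - hval i a * cartan n k i = hval k a
  rw [hval_of_none h h', zero_mul, sub_zero]

theorem spinWeight_topSpin (hn : 1 ≤ n) :
    spinWeight (topSpin n) = fundWeight (lastIdx n hn) := funext fun i => hval_topSpin hn i

theorem rho_neg_of_spin_neg {w : Equiv.Perm (Weight n)} {σ η} (hw : IsSignedPerm w σ η)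
    {i : Fin n} (h : w (spinWeight (topSpin n)) i < 0) : w rho i < 0 := by
  by_cases hi : (i : ℕ) + 1 < n
  · have e1 := coord_of_lt hi (w rho)
    have e2 := coord_of_lt hi (w (spinWeight (topSpin n)))
    rw [hw.2, hw.2, coord_rho, coord_rho] at e1
    rw [hw.2, hw.2, coord_spinWeight, coord_spinWeight] at e2
    have b1 := (σ i).2
    have b2 := (σ ⟨i + 1, hi⟩).2
    simp only [topSpin, sgn] at e2
    rcases hw.1 i with s1 | s1 <;> rcases hw.1 ⟨i + 1, hi⟩ with s2 | s2 <;> rw [s1, s2] at e1 e2 <;>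
        simp at e2 <;> omega
  · have e1 := coord_of_not_lt hi (w rho)
    have e2 := coord_of_not_lt hi (w (spinWeight (topSpin n)))
    rw [hw.2, coord_rho] at e1
    rw [hw.2, coord_spinWeight] at e2
    have b1 := (σ i).2
    simp only [topSpin, sgn] at e2
    rcases hw.1 i with s1 | s1 <;> rw [s1] at e1 e2 <;> simp at e2 <;> omega

theorem exists_wordLift_mulVec_top {a : List (Fin n)} (h : IsReducedWord a) :
    ∃ ε, wordProd a (spinWeight (topSpin n)) = spinWeight ε ∧
      (mat (wordLift a)).mulVec (Pi.single (topSpin n) 1) = Pi.single ε 1 := by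
  induction a with
  | nil => exact ⟨topSpin n, rfl, by simp only [wordLift, List.map_nil, List.prod_nil, mat_one,
      Matrix.one_mulVec]⟩
  | cons i a ih =>
    obtain ⟨ε, h1, h2⟩ := ih h.of_cons
    have hlift : wordLift (i :: a) = sbar i * wordLift a := by simp [wordLift]
    rw [hlift, mat_mul, ← Matrix.mulVec_mulVec, h2, wordProd_cons, Equiv.Perm.mul_apply, h1]
    rcases hl : lower i ε with _ | b
    · rcases hr : raise i ε with _ | b
      · exact ⟨ε, simpleReflection_spinWeight_of_none hl hr, sbar_mulVec_of_none hl hr⟩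
      · exfalso
        have h3 := (hval_of_lower (raise_eq_some_iff.1 hr)).2
        obtain ⟨σ, η, hw⟩ := exists_isSignedPerm_wordProd a
        have h4 := rho_neg_of_spin_neg hw (i := i) (by rw [h1, spinWeight, h3]; norm_num)
        exact absurd h.rho_nonneg (not_le.2 h4)
    · exact ⟨b, simpleReflection_spinWeight_of_lower hl, sbar_mulVec_of_lower hl⟩

/-! The longest element. -/

theorem IsLongest.rho_neg {w₀ : Equiv.Perm (Weight n)} (hw₀ : IsLongest w₀) (i : Fin n) :
    w₀ rho i < 0 := by
  obtain ⟨a, ha, rfl⟩ := exists_isReducedWord hw₀.1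
  obtain ⟨σ, η, hw⟩ := exists_isSignedPerm_wordProd a
  have hne : wordProd a rho i ≠ 0 := by
    by_cases hi : (i : ℕ) + 1 < n
    · have e1 := coord_of_lt hi (wordProd a rho)
      rw [hw.2, hw.2, coord_rho, coord_rho] at e1
      have hne : ((σ i : Fin n) : ℕ) ≠ σ ⟨i + 1, hi⟩ := by
        intro h
        have := σ.injective (Fin.ext h)
        simp [Fin.ext_iff] at this
      have b1 := (σ i).2
      have b2 := (σ ⟨i + 1, hi⟩).2
      rcases hw.1 i with s1 | s1 <;> rcases hw.1 ⟨i + 1, hi⟩ with s2 | s2 <;> rw [s1, s2] at e1 <;>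
        omega
    · have e1 := coord_of_not_lt hi (wordProd a rho)
      rw [hw.2, coord_rho] at e1
      have b1 := (σ i).2
      rcases hw.1 i with s1 | s1 <;> rw [s1] at e1 <;> omega
  by_contra! h
  obtain ⟨b, hb, hb'⟩ := exists_isReducedWord (wordProd_mem (i :: a))
  have h1 : wordProd b rho i < 0 := by
    rw [hb', wordProd_cons]
    change wordProd a rho i - wordProd a rho i * cartan n i i < 0
    have : cartan n i i = 2 := by simp [cartan]
    rw [this]
    omega
  obtain ⟨c, hc, hc'⟩ := exists_shorter_word b i h1
  have h2 := hw₀.2 _ (wordProd_mem b)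
  have h3 := weylLength_wordProd_le c
  rw [← hc', wordProd_cons, hb', wordProd_cons, ← mul_assoc, simpleReflection_mul_self, one_mul]
    at h3
  rw [hb] at h2
  omega

/-- The basis vector `(-, …, -, +)`. -/
def cutSpin (n : ℕ) : Spin n := fun k => decide ((k : ℕ) + 1 = n)

theorem IsLongest.apply_eq (hn : 1 ≤ n) {w₀ : Equiv.Perm (Weight n)} (hw₀ : IsLongest w₀) :
    w₀ (simpleReflection (lastIdx n hn) (fundWeight (lastIdx n hn))) =
      spinWeight (cutSpin n) := by
  have hneg := hw₀.rho_neg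
  obtain ⟨a, ha, rfl⟩ := exists_isReducedWord hw₀.1
  obtain ⟨σ, η, hw⟩ := exists_isSignedPerm_wordProd a
  have hlt : ∀ (k : Fin n) (hk : (k : ℕ) + 1 < n),
      coord (wordProd a rho) k < coord (wordProd a rho) ⟨k + 1, hk⟩ := by
    intro k hk
    have e1 := coord_of_lt hk (wordProd a rho)
    have := hneg k
    omega
  have hcn : ∀ m : ℕ, ∀ k : Fin n, (k : ℕ) + m + 1 = n → coord (wordProd a rho) k < 0 := by
    intro m
    induction m with
    | zero => intro k hk; rw [coord_of_not_lt (by omega)]; exact hneg k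
    | succ m ih =>
      intro k hk
      exact (hlt k (by omega)).trans (ih _ (by simp only; omega))
  have hη : ∀ k, η k = -1 := by
    intro k
    have e1 := hcn (n - 1 - k) k (by have := k.2; omega)
    have b1 := (σ k).2
    rw [hw.2, coord_rho] at e1
    rcases hw.1 k with s1 | s1
    · rw [s1] at e1; omega
    · exact s1
  have hσ : ∀ m : ℕ, ∀ k : Fin n, (k : ℕ) = m → m ≤ σ k := by
    intro m
    induction m with
    | zero => intro k _; exact Nat.zero_le _
    | succ m ih =>
      intro k hk
      have e1 := hlt ⟨m, by omega⟩ (by simp only; omega)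
      have e2 := ih ⟨m, by omega⟩ rfl
      have : (⟨m + 1, by omega⟩ : Fin n) = k := Fin.ext hk.symm
      simp only [this] at e1
      rw [hw.2, hw.2, coord_rho, coord_rho, hη, hη] at e1
      omega
  have hl : σ (lastIdx n hn) = lastIdx n hn := by
    have e1 := hσ (n - 1) (lastIdx n hn) rfl
    have e2 := (σ (lastIdx n hn)).2
    ext
    simp only [lastIdx] at *
    omega
  refine coord_injective (funext fun k => ?_)
  rw [hw.2, coord_simpleReflection_of_not_lt (by simp [lastIdx]; omega), ← spinWeight_topSpin hn,
    coord_spinWeight, coord_spinWeight, hη]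
  have h1 : σ k = lastIdx n hn ↔ k = lastIdx n hn := by
    rw [← hl, σ.injective.eq_iff, hl]
  have h2 : k = lastIdx n hn ↔ (k : ℕ) + 1 = n := by
    simp only [Fin.ext_iff, lastIdx]; omega
  simp only [h1, h2, topSpin, cutSpin, sgn]
  by_cases h3 : (k : ℕ) + 1 = n <;> simp [h3]

/-- The minor is a matrix entry in the spin representation. -/
theorem isGeneralizedMinor_iff (hn : 1 ≤ n) {w₀ : Equiv.Perm (Weight n)} (hw₀ : IsLongest w₀)
    (D : G n → ℂ) : IsGeneralizedMinor (fundWeight (lastIdx n hn))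
        (w₀ (simpleReflection (lastIdx n hn) (fundWeight (lastIdx n hn))))
        (fundWeight (lastIdx n hn)) D ↔ D = fun g => mat g (cutSpin n) (topSpin n) := by
  have key : ∀ a b : List (Fin n), IsReducedWord a → IsReducedWord b →
      wordProd a (fundWeight (lastIdx n hn)) =
        w₀ (simpleReflection (lastIdx n hn) (fundWeight (lastIdx n hn))) →
      wordProd b (fundWeight (lastIdx n hn)) = fundWeight (lastIdx n hn) → ∀ g,
      topEntry ((wordLift a)⁻¹ * g * wordLift b) = mat g (cutSpin n) (topSpin n) := by
    intro a b ha hb hwa hwb g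
    obtain ⟨ε, h1, h2⟩ := exists_wordLift_mulVec_top ha
    obtain ⟨ε', h3, h4⟩ := exists_wordLift_mulVec_top hb
    rw [spinWeight_topSpin hn, hwa, hw₀.apply_eq hn] at h1
    rw [spinWeight_topSpin hn, hwb, ← spinWeight_topSpin hn] at h3
    obtain rfl := spinWeight_injective h1
    obtain rfl := spinWeight_injective h3
    rw [← mat_wordLift_inv_transpose, Matrix.mulVec_transpose] at h2
    have h5 : ∀ (M : Matrix (Spin n) (Spin n) ℂ) ε ε', M ε ε' =
        dotProduct (Pi.single ε 1) (M.mulVec (Pi.single ε' 1)) := by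
      intro M ε ε'; simp
    refine (h5 (mat ((wordLift a)⁻¹ * g * wordLift b)) _ _).trans ?_
    rw [mat_mul, mat_mul, ← Matrix.mulVec_mulVec, h4, ← Matrix.mulVec_mulVec,
      Matrix.dotProduct_mulVec, h2, ← h5]
  constructor
  · rintro ⟨D₀, hD₀, a, b, ha, hb, hwa, hwb, hD⟩
    obtain rfl := hD₀.unique (isPrincipalMinor_topEntry hn)
    funext g
    rw [hD, key a b ha hb hwa hwb]
  · rintro rfl
    obtain ⟨a, ha, ha'⟩ := exists_isReducedWord
      (mul_mem hw₀.1 (simpleReflection_mem (lastIdx n hn)))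
    have hb : IsReducedWord ([] : List (Fin n)) :=
      Nat.le_zero.1 (weylLength_wordProd_le [])
    refine ⟨topEntry, isPrincipalMinor_topEntry hn, a, [], ha, hb, by rw [ha']; rfl, rfl,
      fun g => (key a [] ha hb (by rw [ha']; rfl) rfl g).symm⟩

end TypeB

namespace TypeB

/-! Sweeps: the action of `𝐲_1 ⋯ 𝐲_n` in terms of the sets of sites with sign `-`. -/

/-- `F j S` is the value, at the basis vector with set of minus signs `S`, of the product of the
factors with index at least `j` applied to a vector. -/
structure IsSweep (n : ℕ) (γ : ℕ → ℂ) (F : ℕ → Finset ℕ → ℂ) : Prop where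
  move : ∀ i S, i + 1 < n → i ∈ S → i + 1 ∉ S →
    F i S = γ i * F (i + 1) S + F (i + 1) (insert (i + 1) (S.erase i))
  move_last : ∀ i S, i + 1 = n → i ∈ S → F i S = γ i * F (i + 1) S + F (i + 1) (S.erase i)
  stay : ∀ i S, i + 1 < n → i ∉ S → i + 1 ∈ S → F i S = (γ i)⁻¹ * F (i + 1) S
  stay_last : ∀ i S, i + 1 = n → i ∉ S → F i S = (γ i)⁻¹ * F (i + 1) S
  skip : ∀ i S, i + 1 < n → (i ∈ S ↔ i + 1 ∈ S) → F i S = F (i + 1) S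

namespace IsSweep

variable {n : ℕ} {γ : ℕ → ℂ} {F : ℕ → Finset ℕ → ℂ}

theorem skip_range (hF : IsSweep n γ F) {S : Finset ℕ} {j k : ℕ} (hjk : j ≤ k)
    (h : ∀ l, j ≤ l → l < k → l + 1 < n ∧ (l ∈ S ↔ l + 1 ∈ S)) : F j S = F k S := by
  induction k, hjk using Nat.le_induction with
  | base => rfl
  | succ k hk ih =>
    rw [ih fun l h1 h2 => h l h1 (by omega)]
    obtain ⟨h1, h2⟩ := h k hk (by omega)
    exact hF.skip k S h1 h2

theorem eq_zero_of_subset_range (hF : IsSweep n γ F) {K : ℕ}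
    (hK : ∀ S ⊆ Finset.range n, K < S.card → F n S = 0) {j : ℕ} (hj : j ≤ n) {S : Finset ℕ}
    (hS : S ⊆ Finset.range j) (hc : K < S.card) : F j S = 0 := by
  induction hj using Nat.decreasingInduction with
  | self => exact hK S hS hc
  | of_succ j hj ih =>
    have h1 : j ∉ S := fun h => by simpa using hS h
    have h2 : j + 1 ∉ S := fun h => by simpa using hS h
    have h3 : F (j + 1) S = 0 := ih (hS.trans (Finset.range_subset_range.2 (by omega)))
    rcases Nat.lt_or_ge (j + 1) n with h | h
    · rw [hF.skip j S h (by simp [h1, h2]), h3]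
    · rw [hF.stay_last j S (by omega) h1, h3, mul_zero]

theorem eq_zero_of_card (hF : IsSweep n γ F) {K : ℕ}
    (hK : ∀ S ⊆ Finset.range n, K < S.card → F n S = 0) {j : ℕ} (hj : j ≤ n) {S : Finset ℕ}
    (hS : S ⊆ Finset.range n) (hc : K + 1 < S.card) : F j S = 0 := by
  induction hj using Nat.decreasingInduction generalizing S with
  | self => exact hK S hS (by omega)
  | of_succ j hj ih =>
    rcases Nat.lt_or_ge (j + 1) n with h | h
    · by_cases h1 : j ∈ S <;> by_cases h2 : j + 1 ∈ S
      · rw [hF.skip j S h (by simp [h1, h2]), ih hS hc]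
      · rw [hF.move j S h h1 h2, ih hS hc, ih, mul_zero, add_zero]
        · intro k hk
          rcases Finset.mem_insert.1 hk with rfl | hk
          · exact Finset.mem_range.2 h
          · exact hS (Finset.mem_of_mem_erase hk)
        · rw [Finset.card_insert_of_notMem fun h' => h2 (Finset.mem_of_mem_erase h'),
            Finset.card_erase_of_mem h1]
          omega
      · rw [hF.stay j S h h1 h2, ih hS hc, mul_zero]
      · rw [hF.skip j S h (by simp [h1, h2]), ih hS hc]
    · obtain rfl : n = j + 1 := by omega
      by_cases h1 : j ∈ S
      · rw [hF.move_last j S rfl h1, ih hS hc, hK _ ((Finset.erase_subset _ _).trans hS), mul_zero,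
          add_zero]
        rw [Finset.card_erase_of_mem h1]
        omega
      · rw [hF.stay_last j S rfl h1, ih hS hc, mul_zero]

theorem insert_max (hF : IsSweep n γ F) {S : Finset ℕ}
    (hK : ∀ S' ⊆ Finset.range n, S.card < S'.card → F n S' = 0) {p : ℕ} (hp : p < n)
    (hS : S ⊆ Finset.range p) : F p (insert p S) = F n S := by
  have hp' : p ≤ n - 1 := by omega
  induction hp' using Nat.decreasingInduction with
  | self =>
    obtain ⟨k, rfl⟩ : ∃ k, n = k + 1 := ⟨n - 1, by omega⟩
    simp only [Nat.add_sub_cancel] at *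
    have h1 : k ∉ S := fun h => by simpa using hS h
    rw [hF.move_last k _ rfl (Finset.mem_insert_self _ _), Finset.erase_insert h1,
      hK (insert k S), mul_zero, zero_add]
    · exact Finset.insert_subset (Finset.mem_range.2 (by omega)) (hS.trans (Finset.range_subset_range.2 (by omega)))
    · rw [Finset.card_insert_of_notMem h1]; omega
  | of_succ p hp' ih =>
    have h1 : p ∉ S := fun h => by simpa using hS h
    have h2 : p + 1 ∉ S := fun h => by simpa using hS h
    have h3 : insert p S ⊆ Finset.range (p + 1) :=
      Finset.insert_subset (Finset.mem_range.2 (by omega)) (hS.trans (Finset.range_subset_range.2 (by omega)))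
    rw [hF.move p _ (by omega) (Finset.mem_insert_self _ _) (by simp [h2]), Finset.erase_insert h1,
      ih (by omega) (hS.trans (Finset.range_subset_range.2 (by omega))),
      hF.eq_zero_of_subset_range hK (by omega) h3, mul_zero, zero_add]
    rw [Finset.card_insert_of_notMem h1]; omega

/-- A minus sign at `i` stays there, and the next one, at `p + 1`, stops there. -/
theorem stopped (hF : IsSweep n γ F) {R : Finset ℕ} {i p : ℕ}
    (hK : ∀ S' ⊆ Finset.range n, R.card + 1 < S'.card → F n S' = 0)
    (hR : R ⊆ Finset.range i) (hip : i < p) (hp : p + 1 < n) :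
    F (i + 1) (insert (p + 1) (insert i R)) = (γ p)⁻¹ * F n (insert i R) := by
  have hm : ∀ l, i < l → l ∉ insert i R := fun l hl h => by
    rcases Finset.mem_insert.1 h with rfl | h
    · omega
    · have := Finset.mem_range.1 (hR h); omega
  have hm' : ∀ l, i < l → (l ∈ insert (p + 1) (insert i R) ↔ l = p + 1) := fun l hl => by
    rw [Finset.mem_insert]
    simp only [hm l hl, or_false]
  have hi : i ∉ R := fun h => by simpa using hR h
  rw [hF.skip_range (k := p) (by omega) fun l h1 h2 => ⟨by omega, by
    rw [hm' l (by omega), hm' (l + 1) (by omega)]; omega⟩]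
  rw [hF.stay p _ hp (by rw [hm' p hip]; omega) (by simp),
    hF.insert_max _ hp]
  · exact Finset.insert_subset (Finset.mem_range.2 (by omega)) (hR.trans (Finset.range_subset_range.2 (by omega)))
  · rw [Finset.card_insert_of_notMem hi]; exact hK

theorem insert_insert (hF : IsSweep n γ F) {R : Finset ℕ} {i p : ℕ}
    (hK : ∀ S' ⊆ Finset.range n, R.card + 1 < S'.card → F n S' = 0)
    (hR : R ⊆ Finset.range i) (hip : i ≤ p) (hp : p + 1 < n) :
    F i (insert (p + 1) (insert i R)) =
      (γ p)⁻¹ * ∑ k ∈ Finset.Ico i p, γ k * F n (insert k R) + F n (insert p R) := by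
  induction hip using Nat.decreasingInduction with
  | self =>
    have hi : p ∉ R := fun h => by simpa using hR h
    rw [hF.skip p _ hp (by simp), hF.insert_max _ hp]
    · simp
    · exact Finset.insert_subset (Finset.mem_range.2 (by omega)) (hR.trans (Finset.range_subset_range.2 (by omega)))
    · rw [Finset.card_insert_of_notMem hi]; exact hK
  | of_succ i hi ih =>
    have hiR : i ∉ R := fun h => by simpa using hR h
    have hiR' : i + 1 ∉ R := fun h => by simpa using hR h
    have e : insert (i + 1) ((insert (p + 1) (insert i R)).erase i) =
        insert (p + 1) (insert (i + 1) R) := by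
      rw [Finset.erase_insert_of_ne (by omega), Finset.erase_insert hiR, Finset.insert_comm]
    rw [hF.move i _ (by omega) (by simp) (by simp [hiR']; omega), e,
      ih (hR.trans (Finset.range_subset_range.2 (by omega))), hF.stopped hK hR hi hp,
      ← Finset.sum_Ico_consecutive _ (Nat.le_succ i) hi]
    simp
    ring

theorem insert_last (hF : IsSweep (n + 1) γ F) {R : Finset ℕ} {i : ℕ}
    (hR : R ⊆ Finset.range i) (hi : i ≤ n) :
    F i (insert i R) = (γ n)⁻¹ * ∑ k ∈ Finset.Ico i n, γ k * F (n + 1) (insert k R) +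
      γ n * F (n + 1) (insert n R) + F (n + 1) R := by
  induction hi using Nat.decreasingInduction with
  | self =>
    have hi : n ∉ R := fun h => by simpa using hR h
    rw [hF.move_last n _ rfl (by simp), Finset.erase_insert hi]
    simp
  | of_succ i hi ih =>
    have hm : ∀ l, i < l → l ∉ insert i R := fun l hl h => by
      rcases Finset.mem_insert.1 h with rfl | h
      · omega
      · have := Finset.mem_range.1 (hR h); omega
    have hiR : i ∉ R := fun h => by simpa using hR h
    rw [hF.move i _ (by omega) (by simp) (hm _ (by omega)), Finset.erase_insert hiR,
      ih (hR.trans (Finset.range_subset_range.2 (by omega))),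
      hF.skip_range (j := i + 1) (k := n) (by omega) fun l h1 h2 => ⟨by omega, by
        simp only [hm l (by omega), hm (l + 1) (by omega)]⟩,
      hF.stay_last n _ rfl (hm n hi), ← Finset.sum_Ico_consecutive _ (Nat.le_succ i) hi]
    simp
    ring

theorem zero_insert_range (hF : IsSweep n γ F) {m p : ℕ}
    (hK : ∀ S' ⊆ Finset.range n, m + 1 < S'.card → F n S' = 0) (hm : m ≤ p) (hp : p + 1 < n) :
    F 0 (insert (p + 1) (Finset.range (m + 1))) =
      (γ p)⁻¹ * ∑ k ∈ Finset.Ico m p, γ k * F n (insert k (Finset.range m)) +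
        F n (insert p (Finset.range m)) := by
  rw [hF.skip_range (k := m) (by omega) fun l h1 h2 => ⟨by omega, by simp; omega⟩,
    Finset.range_add_one, hF.insert_insert (by simpa using hK) subset_rfl hm hp]

theorem zero_range (hF : IsSweep (n + 1) γ F) {m : ℕ} (hm : m ≤ n) :
    F 0 (Finset.range (m + 1)) =
      (γ n)⁻¹ * ∑ k ∈ Finset.Ico m n, γ k * F (n + 1) (insert k (Finset.range m)) +
        γ n * F (n + 1) (insert n (Finset.range m)) + F (n + 1) (Finset.range m) := by
  rw [hF.skip_range (k := m) (by omega) fun l h1 h2 => ⟨by omega, by simp; omega⟩,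
    Finset.range_add_one, hF.insert_last subset_rfl hm]

theorem zero_singleton_succ (hF : IsSweep n γ F) {p : ℕ}
    (hK : ∀ S' ⊆ Finset.range n, 0 < S'.card → F n S' = 0) (hp : p + 1 < n) :
    F 0 {p + 1} = (γ p)⁻¹ * F n ∅ := by
  rw [hF.skip_range (k := p) (by omega) fun l h1 h2 => ⟨by omega, by simp; omega⟩,
    hF.stay p _ hp (by simp) (by simp), ← insert_empty_eq, hF.insert_max (by simpa using hK) hp
      (by simp)]

theorem zero_singleton_zero (hF : IsSweep n γ F) (hn : 0 < n)
    (hK : ∀ S' ⊆ Finset.range n, 0 < S'.card → F n S' = 0) : F 0 {0} = F n ∅ := by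
  rw [← insert_empty_eq, hF.insert_max (by simpa using hK) hn (by simp)]

theorem zero_empty (hF : IsSweep (n + 1) γ F) : F 0 ∅ = (γ n)⁻¹ * F (n + 1) ∅ := by
  rw [hF.skip_range (k := n) (by omega) fun l h1 h2 => ⟨by omega, by simp⟩,
    hF.stay_last n _ rfl (by simp)]

end IsSweep

/-! The amplitudes. -/

/-- The amplitudes `(A, A₀)`: generating functions of the sets of `m` steps among the first `p`, where the
next step is, or is not, taken. -/
noncomputable def amp (g : ℕ → ℕ → ℂ) : ℕ → ℕ → ℂ × ℂ
  | 0, 0 => (1, 1)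
  | _ + 1, 0 => (0, 0)
  | 0, p + 1 => ((g 0 p)⁻¹ * (amp g 0 p).2, (amp g 0 p).2)
  | m + 1, p + 1 => ((amp g m p).1 + (g (m + 1) p)⁻¹ * (amp g (m + 1) p).2,
      (amp g (m + 1) p).2 + g (m + 1) p * (amp g m p).1)

theorem amp_zero_snd (g : ℕ → ℕ → ℂ) (p : ℕ) : (amp g 0 p).2 = 1 := by
  induction p with
  | zero => simp [amp]
  | succ p ih => simp [amp, ih]

theorem amp_eq_zero (g : ℕ → ℕ → ℂ) {m p : ℕ} (h : p < m) : amp g m p = (0, 0) := by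
  induction p generalizing m with
  | zero => obtain ⟨k, rfl⟩ : ∃ k, m = k + 1 := ⟨m - 1, by omega⟩; simp [amp]
  | succ p ih =>
    obtain ⟨k, rfl⟩ : ∃ k, m = k + 1 := ⟨m - 1, by omega⟩
    simp [amp, ih (m := k) (by omega), ih (m := k + 1) (by omega)]

theorem amp_succ_snd (g : ℕ → ℕ → ℂ) (m p : ℕ) :
    (amp g (m + 1) p).2 = ∑ k ∈ Finset.Ico m p, g (m + 1) k * (amp g m k).1 := by
  induction p with
  | zero => simp [amp]
  | succ p ih =>
    rw [amp, ih]
    rcases Nat.lt_or_ge p m with h | h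
    · rw [Finset.Ico_eq_empty (by omega), Finset.Ico_eq_empty (by omega), amp_eq_zero g h]; simp
    · rw [Finset.sum_Ico_succ_top h]

/-- The contribution of the sets of `m` steps among `n + 1`. -/
noncomputable def ampTotal (g : ℕ → ℕ → ℂ) (n : ℕ) : ℕ → ℂ
  | 0 => (g 0 n)⁻¹ * (amp g 0 n).2
  | m + 1 => (g (m + 1) n)⁻¹ * (amp g (m + 1) n).2 + g (m + 1) n * (amp g m n).1

theorem sweeps_apply {n : ℕ} {g : ℕ → ℕ → ℂ} {F : ℕ → ℕ → Finset ℕ → ℂ} {ψ : ℕ → Finset ℕ → ℂ}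
    (hF : ∀ m ≤ n, IsSweep (n + 1) (g m) (F m)) (h0 : ∀ m ≤ n, F m (n + 1) = ψ m)
    (h1 : ∀ m ≤ n, F m 0 = ψ (m + 1)) (hψ : ψ 0 ∅ = 1)
    (hψ' : ∀ S ⊆ Finset.range (n + 1), 0 < S.card → ψ 0 S = 0) {m : ℕ} (hm : m ≤ n) :
    (∀ S ⊆ Finset.range (n + 1), m + 1 < S.card → ψ (m + 1) S = 0) ∧
    (∀ p, m ≤ p → p ≤ n → ψ (m + 1) (insert p (Finset.range m)) = (amp g m p).1) ∧
    ψ (m + 1) (Finset.range m) = ∑ k ∈ Finset.range (m + 1), ampTotal g n k := by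
  induction m with
  | zero =>
    have hF := hF 0 hm
    have e0 := h0 0 hm
    have hψ'' : ∀ S ⊆ Finset.range (n + 1), 0 < S.card → F 0 (n + 1) S = 0 := by rwa [e0]
    rw [← h1 0 hm]
    refine ⟨fun S hS hc => hF.eq_zero_of_card hψ'' (Nat.zero_le _) hS hc, fun p _ hp => ?_, ?_⟩
    · rcases p with _ | p
      · simpa [amp, e0, hψ] using hF.zero_singleton_zero (Nat.succ_pos n) hψ''
      · simpa [amp, e0, hψ, amp_zero_snd] using hF.zero_singleton_succ hψ'' (Nat.lt_succ_of_le hp)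
    · simpa [ampTotal, e0, hψ, amp_zero_snd] using hF.zero_empty
  | succ m ih =>
    obtain ⟨i1, i2, i3⟩ := ih (by omega)
    have hF := hF (m + 1) hm
    have e0 := h0 (m + 1) hm
    rw [← e0] at i1 i2 i3
    rw [← h1 (m + 1) hm]
    have hsum : ∀ p ≤ n, ∑ k ∈ Finset.Ico m p, g (m + 1) k *
        F (m + 1) (n + 1) (insert k (Finset.range m)) = (amp g (m + 1) p).2 := by
      intro p hp
      rw [amp_succ_snd]
      refine Finset.sum_congr rfl fun k hk => ?_
      rw [Finset.mem_Ico] at hk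
      rw [i2 k hk.1 (by omega)]
    refine ⟨fun S hS hc => hF.eq_zero_of_card i1 (Nat.zero_le _) hS hc, fun p hmp hp => ?_, ?_⟩
    · obtain ⟨p, rfl⟩ : ∃ k, p = k + 1 := ⟨p - 1, by omega⟩
      rw [hF.zero_insert_range i1 (by omega) (by omega), hsum p (by omega),
        i2 p (by omega) (by omega), amp, add_comm]
    · rw [hF.zero_range (by omega), hsum n le_rfl, i2 n (by omega) le_rfl, i3,
        Finset.sum_range_succ _ (m + 1), ampTotal, add_comm]

/-! The factors `𝐲_i` in the spin representation. -/

theorem mat_alphaCheck_mulVec_apply (i : Fin n) (c : ℂˣ) (ψ : Spin n → ℂ) (a : Spin n) :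
    (mat (alphaCheck i c)).mulVec ψ a = ((c ^ hval i a : ℂˣ) : ℂ) * ψ a :=
  powH_mulVec_apply i c ψ a

theorem yBold_mulVec_of_raise {i : Fin n} {a b : Spin n} (h : raise i a = some b) (c : ℂˣ)
    (ψ : Spin n → ℂ) : (mat (yBold i c)).mulVec ψ a = c * ψ a + ψ b := by
  have h1 := hval_of_lower (raise_eq_some_iff.1 h)
  rw [yBold, mat_mul, mat_ySub, ← Matrix.mulVec_mulVec, Matrix.add_mulVec, Matrix.one_mulVec,
    Matrix.smul_mulVec, Pi.add_apply, Pi.smul_apply, fMat_mulVec_apply, h]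
  simp only [Option.elim_some, mat_alphaCheck_mulVec_apply, h1]
  simp

theorem yBold_mulVec_of_none {i : Fin n} {a : Spin n} (h : raise i a = none) (c : ℂˣ)
    (ψ : Spin n → ℂ) : (mat (yBold i c)).mulVec ψ a = ((c⁻¹ ^ hval i a : ℂˣ) : ℂ) * ψ a := by
  rw [yBold, mat_mul, mat_ySub, ← Matrix.mulVec_mulVec, Matrix.add_mulVec, Matrix.one_mulVec,
    Matrix.smul_mulVec, Pi.add_apply, Pi.smul_apply, fMat_mulVec_apply, h]
  simp [mat_alphaCheck_mulVec_apply]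

/-- The basis vector with set of minus signs `S`. -/
def minusSpin (n : ℕ) (S : Finset ℕ) : Spin n := fun k => decide ((k : ℕ) ∉ S)

theorem raise_minusSpin {i : Fin n} {S : Finset ℕ} (h : (i : ℕ) ∈ S)
    (h2 : (i : ℕ) + 1 ∉ S) :
    raise i (minusSpin n S) = some (minusSpin n (insert ((i : ℕ) + 1) (S.erase i))) := by
  refine raise_eq_some_iff'.2 ⟨by simp [minusSpin, h], fun k hk => by simp [minusSpin, hk, h2],
    fun k => ?_⟩
  simp only [minusSpin, Finset.mem_insert, Finset.mem_erase, Fin.ext_iff]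
  split_ifs with h3 h4
  · simp [h3]
  · simp [h4]
  · simp [h3, h4]

theorem raise_minusSpin_last {i : Fin n} {S : Finset ℕ} (h : (i : ℕ) ∈ S) (h1 : (i : ℕ) + 1 = n) :
    raise i (minusSpin n S) = some (minusSpin n (S.erase i)) := by
  refine raise_eq_some_iff'.2 ⟨by simp [minusSpin, h], fun k hk => absurd k.2 (by omega),
    fun k => ?_⟩
  have := k.2
  simp only [minusSpin, Finset.mem_erase, Fin.ext_iff]
  split_ifs with h3 h4
  · simp [h3]
  · omega
  · simp [h3]

theorem raise_minusSpin_of_notMem {i : Fin n} {S : Finset ℕ} (h : (i : ℕ) ∉ S) :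
    raise i (minusSpin n S) = none := by
  rcases h' : raise i (minusSpin n S) with _ | b
  · rfl
  · simpa [minusSpin, h] using (raise_eq_some_iff'.1 h').1

theorem raise_minusSpin_of_mem {i : Fin n} {S : Finset ℕ} (h1 : (i : ℕ) + 1 < n)
    (h : (i : ℕ) + 1 ∈ S) : raise i (minusSpin n S) = none := by
  rcases h' : raise i (minusSpin n S) with _ | b
  · rfl
  · simpa [minusSpin, h] using (raise_eq_some_iff'.1 h').2.1 ⟨i + 1, h1⟩ rfl

/-- A function on `Fin n` with values in the units, as a function on `ℕ`. -/
noncomputable def extend (γ : Fin n → ℂˣ) (i : ℕ) : ℂ := if h : i < n then γ ⟨i, h⟩ else 1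

theorem isSweep_mulVec (γ : Fin n → ℂˣ) (ψ : Spin n → ℂ) :
    IsSweep n (extend γ) fun j S =>
      (mat ((List.ofFn fun i => yBold i (γ i)).drop j).prod).mulVec ψ (minusSpin n S) := by
  have key : ∀ i (hi : i < n), (mat ((List.ofFn fun i => yBold i (γ i)).drop i).prod).mulVec ψ =
      (mat (yBold ⟨i, hi⟩ (γ ⟨i, hi⟩))).mulVec
        ((mat ((List.ofFn fun i => yBold i (γ i)).drop (i + 1)).prod).mulVec ψ) := by
    intro i hi
    rw [List.drop_eq_getElem_cons (by simpa using hi), List.prod_cons, mat_mul,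
      Matrix.mulVec_mulVec, List.getElem_ofFn]
  constructor
  · intro i S h1 h2 h3
    have hi : i < n := by omega
    simp only [extend, dif_pos hi]
    rw [key i hi, yBold_mulVec_of_raise (raise_minusSpin h2 h3)]
  · intro i S h1 h2
    have hi : i < n := by omega
    simp only [extend, dif_pos hi]
    rw [key i hi, yBold_mulVec_of_raise (raise_minusSpin_last h2 h1)]
  · intro i S h1 h2 h3
    have hi : i < n := by omega
    simp only [extend, dif_pos hi]
    rw [key i hi, yBold_mulVec_of_none (raise_minusSpin_of_notMem h2)]
    simp [hval, minusSpin, h1, h2, h3]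
  · intro i S h1 h2
    have hi : i < n := by omega
    simp only [extend, dif_pos hi]
    rw [key i hi, yBold_mulVec_of_none (raise_minusSpin_of_notMem h2)]
    simp [hval, minusSpin, h1, h2]
  · intro i S h1 h2
    have hi : i < n := by omega
    rw [key i hi, yBold_mulVec_of_none]
    · by_cases h3 : i + 1 ∈ S
      · simp [hval, minusSpin, h1, h2, h3]
      · simp [hval, minusSpin, h1, h2, h3]
    · by_cases h3 : i + 1 ∈ S
      · exact raise_minusSpin_of_mem h1 h3
      · exact raise_minusSpin_of_notMem (by simpa [h2] using h3)

/-- The matrix entry of `Θ⁻(c)` giving the minor. -/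
theorem mat_Theta_apply (n : ℕ) (c : Fin (n + 1) → ℤ → ℂˣ) :
    mat (Theta c) (cutSpin (n + 1)) (topSpin (n + 1)) = ∑ k ∈ Finset.range (n + 1),
      ampTotal (fun m => extend fun i => c i (((n + 1 : ℕ) : ℤ) - m)) n k := by
  set L : List (G (n + 1)) := List.ofFn fun j : Fin (n + 1) =>
    (List.ofFn fun i : Fin (n + 1) => yBold i (c i (((j : ℕ) : ℤ) + 1))).prod with hL
  set φ : ℕ → Spin (n + 1) → ℂ := fun j =>
    (mat (L.drop j).prod).mulVec (Pi.single (topSpin (n + 1)) 1) with hφ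
  have hφs : ∀ m ≤ n, φ (n - m) = (mat (List.ofFn fun i : Fin (n + 1) =>
      yBold i (c i (((n + 1 : ℕ) : ℤ) - m))).prod).mulVec (φ (n + 1 - m)) := by
    intro m hm
    have e : n + 1 - m = n - m + 1 := by omega
    have e' : (((n - m : ℕ) : ℤ) + 1) = ((n + 1 : ℕ) : ℤ) - m := by push_cast [hm]; ring
    simp only [hφ]
    rw [e, List.drop_eq_getElem_cons (by simp [hL]), List.prod_cons, mat_mul,
      Matrix.mulVec_mulVec]
    simp only [hL, List.getElem_ofFn, e']
  have hend : φ (n + 1) = Pi.single (topSpin (n + 1)) 1 := by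
    simp only [hφ]
    rw [List.drop_of_length_le (by simp [hL]), List.prod_nil, mat_one, Matrix.one_mulVec]
  have h := sweeps_apply (n := n) (g := fun m => extend fun i => c i (((n + 1 : ℕ) : ℤ) - m))
    (F := fun m j S => (mat ((List.ofFn fun i : Fin (n + 1) =>
      yBold i (c i (((n + 1 : ℕ) : ℤ) - m))).drop j).prod).mulVec (φ (n + 1 - m))
        (minusSpin (n + 1) S))
    (ψ := fun m S => φ (n + 1 - m) (minusSpin (n + 1) S))
    (fun m _ => isSweep_mulVec _ _) (fun m _ => ?_) (fun m hm => ?_) ?_ (fun S hS hc => ?_)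
    (le_refl n)
  · have h3 := h.2.2
    have e : minusSpin (n + 1) (Finset.range n) = cutSpin (n + 1) := by
      funext k
      have := k.2
      simp only [minusSpin, cutSpin, Finset.mem_range, decide_eq_decide]
      omega
    rw [← h3, e, Nat.sub_self]
    simp only [hφ, List.drop_zero]
    simp [Theta, hL]
  · funext S
    rw [List.drop_of_length_le (by simp), List.prod_nil, mat_one, Matrix.one_mulVec]
  · funext S
    rw [List.drop_zero, ← hφs m hm, Nat.add_sub_add_right]
  · have : minusSpin (n + 1) ∅ = topSpin (n + 1) := by funext k; simp [minusSpin, topSpin]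
    simp [hend, this]
  · have : minusSpin (n + 1) S ≠ topSpin (n + 1) := by
      intro h
      obtain ⟨k, hk⟩ := Finset.card_pos.1 hc
      have := congrFun h ⟨k, Finset.mem_range.1 (hS hk)⟩
      simp [minusSpin, topSpin, hk] at this
    simp [hend, this]

/-! Sums over sets of steps. -/

/-- The number of elements of `P` below `r`. -/
def countBelow (P : Finset ℕ) (r : ℕ) : ℕ := (P.filter (· < r)).card

theorem countBelow_succ (P : Finset ℕ) (r : ℕ) :
    countBelow P (r + 1) = countBelow P r + if r ∈ P then 1 else 0 := by
  have : P.filter (· < r + 1) = P.filter (· < r) ∪ P.filter (· = r) := by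
    ext k; simp only [Finset.mem_filter, Finset.mem_union]; grind
  rw [countBelow, this, Finset.card_union_of_disjoint, Finset.filter_eq', countBelow]
  · split_ifs <;> simp
  · rw [Finset.disjoint_filter]; intro k _ h1 h2; omega

theorem countBelow_of_subset {P : Finset ℕ} {r : ℕ} (h : P ⊆ Finset.range r) :
    countBelow P r = P.card := by
  rw [countBelow, Finset.filter_true_of_mem fun k hk => Finset.mem_range.1 (h hk)]

theorem countBelow_congr {P Q : Finset ℕ} {r : ℕ} (h : ∀ k < r, (k ∈ P ↔ k ∈ Q)) :
    countBelow P r = countBelow Q r := by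
  unfold countBelow
  congr 1
  ext k
  simp only [Finset.mem_filter]
  constructor <;> rintro ⟨h1, h2⟩ <;> simp_all

/-- The contribution of a row to the weight of a set of steps. -/
noncomputable def rowWeight (g : ℕ → ℕ → ℂ) (P : Finset ℕ) (i : ℕ) : ℂ :=
  if i ∉ P ∧ i + 1 ∈ P then (g (countBelow P (i + 1)) i)⁻¹
  else if i ∈ P ∧ i + 1 ∉ P then g (countBelow P (i + 1)) i
  else 1

theorem rowWeight_congr (g : ℕ → ℕ → ℂ) {P Q : Finset ℕ} {i : ℕ}
    (h : ∀ k ≤ i + 1, (k ∈ P ↔ k ∈ Q)) : rowWeight g P i = rowWeight g Q i := by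
  simp only [rowWeight, h i (by omega), h (i + 1) le_rfl,
    countBelow_congr (r := i + 1) fun k hk => h k (by omega)]

theorem prod_rowWeight_succ (g : ℕ → ℕ → ℂ) {P : Finset ℕ} {p : ℕ}
    (hP : P ⊆ Finset.range p) :
    ∏ i ∈ Finset.range (p + 1), rowWeight g P i = ∏ i ∈ Finset.range p, rowWeight g P i := by
  have h1 : p ∉ P := fun h => by simpa using hP h
  have h2 : p + 1 ∉ P := fun h => by simpa using hP h
  rw [Finset.prod_range_succ, rowWeight, if_neg (by simp [h2]), if_neg (by simp [h1]), mul_one]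

theorem prod_rowWeight_insert (g : ℕ → ℕ → ℂ) {P : Finset ℕ} {p : ℕ}
    (hP : P ⊆ Finset.range p) :
    ∏ i ∈ Finset.range (p + 1), rowWeight g (insert p P) i =
    (∏ i ∈ Finset.range p, rowWeight g (insert p P) i) * g (P.card + 1) p := by
  have h1 : p ∉ P := fun h => by simpa using hP h
  have h2 : p + 1 ∉ P := fun h => by simpa using hP h
  have h3 : countBelow (insert p P) (p + 1) = P.card + 1 := by
    rw [countBelow_of_subset, Finset.card_insert_of_notMem h1]
    exact Finset.insert_subset (by simp) (hP.trans (Finset.range_subset_range.2 (by omega)))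
  rw [Finset.prod_range_succ]
  congr 1
  rw [rowWeight, if_neg (by simp), if_pos (by simp [h2]), h3]

theorem prod_rowWeight_insert_succ (g : ℕ → ℕ → ℂ) {P : Finset ℕ} {p : ℕ}
    (hP : P ⊆ Finset.range p) :
    ∏ i ∈ Finset.range (p + 1), rowWeight g (insert (p + 1) P) i =
    (∏ i ∈ Finset.range p, rowWeight g P i) * (g P.card p)⁻¹ := by
  have h1 : p ∉ P := fun h => by simpa using hP h
  have h2 : p + 1 ∉ P := fun h => by simpa using hP h
  have h3 : countBelow (insert (p + 1) P) (p + 1) = P.card := by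
    rw [countBelow_congr (Q := P), countBelow_of_subset]
    · exact hP.trans (Finset.range_subset_range.2 (by omega))
    · intro k hk; simp; omega
  rw [Finset.prod_range_succ]
  congr 1
  · refine Finset.prod_congr rfl fun i hi => rowWeight_congr g fun k hk => ?_
    rw [Finset.mem_range] at hi
    rw [Finset.mem_insert]
    simp; omega
  · rw [rowWeight, if_pos (by simp [h1]), h3]

theorem prod_rowWeight_insert_insert (g : ℕ → ℕ → ℂ) (P : Finset ℕ) (p : ℕ) :
    ∏ i ∈ Finset.range (p + 1), rowWeight g (insert (p + 1) (insert p P)) i =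
    ∏ i ∈ Finset.range p, rowWeight g (insert p P) i := by
  rw [Finset.prod_range_succ, rowWeight, if_neg (by simp), if_neg (by simp), mul_one]
  refine Finset.prod_congr rfl fun i hi => rowWeight_congr g fun k hk => ?_
  rw [Finset.mem_range] at hi
  rw [Finset.mem_insert]
  simp; omega

theorem sum_powersetCard_range_succ (f : Finset ℕ → ℂ) (m p : ℕ) :
    ∑ P ∈ Finset.powersetCard (m + 1) (Finset.range (p + 1)), f P =
      ∑ P ∈ Finset.powersetCard (m + 1) (Finset.range p), f P +
        ∑ P ∈ Finset.powersetCard m (Finset.range p), f (insert p P) := by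
  rw [Finset.range_add_one, Finset.powersetCard_succ_insert (by simp), Finset.sum_union,
    Finset.sum_image]
  · intro P hP Q hQ h
    have h1 : p ∉ P := fun h => by simpa using (Finset.mem_powersetCard.1 hP).1 h
    have h2 : p ∉ Q := fun h => by simpa using (Finset.mem_powersetCard.1 hQ).1 h
    simpa [Finset.erase_insert h1, Finset.erase_insert h2] using congrArg (Finset.erase · p) h
  · rw [Finset.disjoint_left]
    intro P hP hP'
    obtain ⟨Q, -, rfl⟩ := Finset.mem_image.1 hP'
    simpa using (Finset.mem_powersetCard.1 hP).1 (Finset.mem_insert_self p Q)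

theorem sum_rowWeight (g : ℕ → ℕ → ℂ) (p m : ℕ) :
    ∑ P ∈ Finset.powersetCard m (Finset.range p),
      ∏ i ∈ Finset.range p, rowWeight g (insert p P) i = (amp g m p).1 ∧
    ∑ P ∈ Finset.powersetCard m (Finset.range p),
      ∏ i ∈ Finset.range p, rowWeight g P i = (amp g m p).2 := by
  induction p generalizing m with
  | zero => rcases m with _ | m <;> simp [amp]
  | succ p ih =>
    rcases m with _ | m
    · have h := (ih 0).2
      simp only [Finset.powersetCard_zero, Finset.sum_singleton] at h ⊢
      rw [prod_rowWeight_insert_succ g (Finset.empty_subset _),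
        prod_rowWeight_succ g (Finset.empty_subset _), h]
      simp [amp, mul_comm]
    · rw [sum_powersetCard_range_succ, sum_powersetCard_range_succ, amp, ← (ih m).1,
        ← (ih (m + 1)).2, Finset.mul_sum, Finset.mul_sum]
      constructor
      · rw [add_comm]
        congr 1
        · refine Finset.sum_congr rfl fun P hP => ?_
          rw [prod_rowWeight_insert_insert]
        · refine Finset.sum_congr rfl fun P hP => ?_
          rw [Finset.mem_powersetCard] at hP
          rw [prod_rowWeight_insert_succ g hP.1, hP.2, mul_comm]
      · congr 1
        · refine Finset.sum_congr rfl fun P hP => ?_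
          rw [prod_rowWeight_succ g (Finset.mem_powersetCard.1 hP).1]
        · refine Finset.sum_congr rfl fun P hP => ?_
          rw [Finset.mem_powersetCard] at hP
          rw [prod_rowWeight_insert g hP.1, hP.2, mul_comm]

/-- The weight of a set of steps among `n + 1`. -/
noncomputable def stepWeight (g : ℕ → ℕ → ℂ) (n : ℕ) (P : Finset ℕ) : ℂ :=
  (∏ i ∈ Finset.range n, rowWeight g P i) * if n ∈ P then g P.card n else (g P.card n)⁻¹

theorem sum_stepWeight (g : ℕ → ℕ → ℂ) (n m : ℕ) :
    ∑ P ∈ Finset.powersetCard m (Finset.range (n + 1)), stepWeight g n P = ampTotal g n m := by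
  have h1 : ∀ {P m}, P ∈ Finset.powersetCard m (Finset.range n) → n ∉ P := fun hP h => by
    simpa using (Finset.mem_powersetCard.1 hP).1 h
  rcases m with _ | m
  · have h := (sum_rowWeight g n 0).2
    simp only [Finset.powersetCard_zero, Finset.sum_singleton] at h ⊢
    rw [stepWeight, h, ampTotal]
    simp [mul_comm]
  · rw [sum_powersetCard_range_succ, ampTotal, ← (sum_rowWeight g n m).1,
      ← (sum_rowWeight g n (m + 1)).2, Finset.mul_sum, Finset.mul_sum]
    congr 1
    · refine Finset.sum_congr rfl fun P hP => ?_
      rw [stepWeight, if_neg (h1 hP), (Finset.mem_powersetCard.1 hP).2, mul_comm]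
    · refine Finset.sum_congr rfl fun P hP => ?_
      rw [stepWeight, if_pos (Finset.mem_insert_self _ _), Finset.card_insert_of_notMem (h1 hP),
        (Finset.mem_powersetCard.1 hP).2, mul_comm]

theorem sum_stepWeight_ne (g : ℕ → ℕ → ℂ) (n : ℕ) :
    ∑ P ∈ (Finset.range (n + 1)).powerset \ {Finset.range (n + 1)}, stepWeight g n P =
      ∑ k ∈ Finset.range (n + 1), ampTotal g n k := by
  have h := Finset.sum_powerset (Finset.range (n + 1)) (stepWeight g n)
  rw [Finset.card_range, Finset.sum_range_succ] at h
  simp only [sum_stepWeight] at h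
  have h2 := sum_stepWeight g n (n + 1)
  have h3 : Finset.powersetCard (n + 1) (Finset.range (n + 1)) = {Finset.range (n + 1)} := by
    conv_lhs => rw [← Finset.card_range (n + 1)]
    rw [Finset.card_range]
    simpa using Finset.powersetCard_self (Finset.range (n + 1))
  rw [h3, Finset.sum_singleton] at h2
  rw [Finset.sum_sdiff_eq_sub (by simp), h, Finset.sum_singleton, h2]
  ring

/-! Triangles and sets of steps. -/

theorem countBelow_le (P : Finset ℕ) (r : ℕ) : countBelow P r ≤ r := by
  induction r with
  | zero => simp [countBelow]
  | succ r ih => rw [countBelow_succ]; split_ifs <;> omega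

theorem countBelow_range {m r : ℕ} (h : r ≤ m) : countBelow (Finset.range m) r = r := by
  induction r with
  | zero => simp [countBelow]
  | succ r ih => rw [countBelow_succ, ih (by omega), if_pos (by simp; omega)]

/-- The triangle whose label increases at the steps in `P`. -/
def triangleOf (n : ℕ) (P : Finset ℕ) : TriArray n := fun l k =>
  if (k : ℕ) < countBelow P (l + 1) then ⟨k + 1, by omega⟩ else ⟨k + 2, by omega⟩

theorem triangleOf_val (P : Finset ℕ) (l : Fin n) (k : Fin ((l : ℕ) + 1)) :
    (triangleOf n P l k : ℕ) = if (k : ℕ) < countBelow P (l + 1) then (k : ℕ) + 1 else k + 2 := by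
  unfold triangleOf
  split_ifs <;> rfl

theorem triangleOf_mem (P : Finset ℕ) : triangleOf n P ∈ triangles n := by
  rw [triangles, Finset.mem_filter]
  refine ⟨Finset.mem_univ _, fun l k => ?_, fun l h k => ?_⟩
  · have h1 := k.2
    have h2 := l.2
    rw [triangleOf_val]
    split_ifs <;> omega
  · have h1 := countBelow_succ P (l + 1)
    rw [Fin.le_def, Fin.lt_def, triangleOf_val, triangleOf_val, triangleOf_val, Fin.val_castSucc,
      Fin.val_succ]
    simp only
    constructor <;> split_ifs at * <;> omega

theorem IsRowLabel.rowLabel_eq {t : TriArray n} {l : Fin n} {s : ℕ} (h : IsRowLabel t l s) :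
    rowLabel t l = s := by
  have key : ∀ {s s'}, IsRowLabel t l s → IsRowLabel t l s' → ¬ s < s' := by
    intro s s' ⟨h1, h2, h3⟩ ⟨h1', h2', h3'⟩ hlt
    have e1 := h3 ⟨s - 1, by omega⟩
    have e2 := h3' ⟨s - 1, by omega⟩
    simp only at e1 e2
    rw [e1, if_neg (by omega), if_pos (by omega)] at e2
    omega
  have hm : IsRowLabel t l (rowLabel t l) := Nat.sInf_mem (s := {s | IsRowLabel t l s}) ⟨s, h⟩
  exact le_antisymm (not_lt.1 (key h hm)) (not_lt.1 (key hm h))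

theorem isRowLabel_triangleOf (P : Finset ℕ) (l : Fin n) :
    IsRowLabel (triangleOf n P) l (countBelow P (l + 1) + 1) := by
  refine ⟨by omega, by have := countBelow_le P (l + 1); omega, fun k => ?_⟩
  rw [triangleOf_val]
  simp only [Nat.add_lt_add_iff_right]

theorem label₀_triangleOf (P : Finset ℕ) {r : ℕ} (hr : r ≤ n) :
    label₀ (triangleOf n P) r = countBelow P r + 1 := by
  unfold label₀
  split_ifs with h
  · rw [(isRowLabel_triangleOf P _).rowLabel_eq]
    simp only [Nat.sub_add_cancel h.1]
  · obtain rfl : r = 0 := by omega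
    simp [countBelow]

theorem label_triangleOf (P : Finset ℕ) {r : ℕ} (hr : r ≤ n) :
    label (triangleOf n P) r = countBelow P r + 1 := by
  rw [label, if_neg (by omega), label₀_triangleOf P hr]

theorem label_triangleOf_last (P : Finset ℕ) :
    label (triangleOf n P) (n + 1) = countBelow P (n - 1) + 2 := by
  rw [label, if_pos rfl, label₀_triangleOf P (by omega)]

theorem triangleOf_range : triangleOf n (Finset.range n) = lowestTriangle n := by
  funext l k
  ext
  have := k.2
  rw [triangleOf_val, countBelow_range (by omega), if_pos (by omega)]
  rfl

theorem triangleOf_injOn : Set.InjOn (triangleOf n) {P | P ⊆ Finset.range n} := by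
  have key : ∀ P Q : Finset ℕ, P ⊆ Finset.range n → triangleOf n P = triangleOf n Q → P ⊆ Q := by
    intro P Q hP h r hr
    have hrn := Finset.mem_range.1 (hP hr)
    have h1 := label_triangleOf (n := n) P (r := r) (by omega)
    have h2 := label_triangleOf (n := n) P (r := r + 1) (by omega)
    rw [h, label_triangleOf Q (by omega)] at h1 h2
    by_contra hQ
    rw [countBelow_succ, countBelow_succ, if_pos hr, if_neg hQ] at h2
    omega
  intro P hP Q hQ h
  exact (key P Q hP h).antisymm (key Q P hQ h.symm)

theorem exists_missing {f : ℕ → ℕ} {m : ℕ} (h1 : ∀ k < m, f k = k + 1 ∨ f k = k + 2)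
    (h2 : ∀ k, k + 1 < m → f k < f (k + 1)) :
    ∃ s, 1 ≤ s ∧ s ≤ m + 1 ∧ ∀ k < m, f k = if k + 1 < s then k + 1 else k + 2 := by
  induction m with
  | zero => exact ⟨1, by omega, by omega, fun k hk => by omega⟩
  | succ m ih =>
    obtain ⟨s, hs1, hs2, hs3⟩ := ih (fun k hk => h1 k (by omega)) (fun k hk => h2 k (by omega))
    rcases Nat.lt_or_ge s (m + 1) with hs | hs
    · refine ⟨s, hs1, by omega, fun k hk => ?_⟩
      rcases Nat.lt_succ_iff_lt_or_eq.1 hk with hk | rfl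
      · exact hs3 k hk
      · have h3 := hs3 (k - 1) (by omega)
        have h4 := h2 (k - 1) (by omega)
        have h5 := h1 k (by omega)
        rw [Nat.sub_add_cancel (by omega)] at h3 h4
        split_ifs at * <;> omega
    · rcases h1 m (by omega) with h3 | h3
      · refine ⟨m + 2, by omega, by omega, fun k hk => ?_⟩
        rcases Nat.lt_succ_iff_lt_or_eq.1 hk with hk | rfl
        · rw [hs3 k hk]; split_ifs <;> omega
        · rw [h3, if_pos (by omega)]
      · refine ⟨m + 1, by omega, by omega, fun k hk => ?_⟩
        rcases Nat.lt_succ_iff_lt_or_eq.1 hk with hk | rfl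
        · rw [hs3 k hk]; split_ifs <;> omega
        · rw [h3, if_neg (by omega)]

/-- The entries of a triangle, indexed by natural numbers. -/
def entry (t : TriArray n) (l k : ℕ) : ℕ :=
  if h : l < n ∧ k < l + 1 then t ⟨l, h.1⟩ ⟨k, h.2⟩ else 0

theorem exists_isRowLabel {t : TriArray n} (ht : IsTriangle t) (l : Fin n) :
    ∃ s, IsRowLabel t l s := by
  have hb : ∀ l k, l < n → k ≤ l → 1 ≤ entry t l k ∧ entry t l k ≤ n + 1 := by
    intro l k hl hk
    rw [entry, dif_pos ⟨hl, by omega⟩]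
    exact ht.1 _ _
  have hs : ∀ l k, l + 1 < n → k ≤ l →
      entry t (l + 1) k ≤ entry t l k ∧ entry t l k < entry t (l + 1) (k + 1) := by
    intro l k hl hk
    simp only [entry, dif_pos (show l + 1 < n ∧ k < l + 1 + 1 by omega),
      dif_pos (show l < n ∧ k < l + 1 by omega),
      dif_pos (show l + 1 < n ∧ k + 1 < l + 1 + 1 by omega)]
    exact ht.2 ⟨l, by omega⟩ hl ⟨k, Nat.lt_succ_of_le hk⟩
  have hinc : ∀ l k, l < n → k + 1 ≤ l → entry t l k < entry t l (k + 1) := by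
    intro l k hl hk
    obtain ⟨m, rfl⟩ : ∃ m, l = m + 1 := ⟨l - 1, by omega⟩
    have := hs m k hl (by omega)
    omega
  have hlow : ∀ k l, l < n → k ≤ l → k + 1 ≤ entry t l k := by
    intro k
    induction k with
    | zero => intro l hl hk; exact (hb l 0 hl hk).1
    | succ k ih =>
      intro l hl hk
      have h1 := hinc l k hl hk
      have h2 := ih l hl (by omega)
      omega
  have hup0 : ∀ m k, k + m + 1 = n → entry t (n - 1) k ≤ k + 2 := by
    intro m
    induction m with
    | zero => intro k hk; have := (hb (n - 1) k (by omega) (by omega)).2; omega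
    | succ m ih =>
      intro k hk
      have h1 := ih (k + 1) (by omega)
      have h2 := hinc (n - 1) k (by omega) (by omega)
      omega
  have hup : ∀ m l k, l + m + 1 = n → k ≤ l → entry t l k ≤ k + 2 := by
    intro m
    induction m with
    | zero =>
      intro l k hl hk
      obtain rfl : l = n - 1 := by omega
      exact hup0 (n - 1 - k) k (by omega)
    | succ m ih =>
      intro l k hl hk
      have h1 := ih (l + 1) (k + 1) (by omega) (by omega)
      have h2 := hs l k (by omega) hk
      omega
  have hl := l.2
  obtain ⟨s, h1, h2, h3⟩ := exists_missing (f := entry t l) (m := (l : ℕ) + 1)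
    (fun k hk => by
      have e1 := hlow k l hl (by omega)
      have e2 := hup (n - 1 - l) l k (by omega) (by omega)
      omega)
    (fun k hk => hinc l k hl (by omega))
  refine ⟨s, h1, h2, fun k => ?_⟩
  have := h3 k k.2
  rwa [entry, dif_pos ⟨hl, k.2⟩] at this

theorem exists_triangleOf_eq {t : TriArray n} (ht : IsTriangle t) :
    ∃ P ⊆ Finset.range n, triangleOf n P = t := by
  choose s hs using exists_isRowLabel ht
  set S : ℕ → ℕ := fun r => if h : 1 ≤ r ∧ r ≤ n then s ⟨r - 1, by omega⟩ else 1 with hS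
  have hSl : ∀ l : Fin n, S (l + 1) = s l := fun l => by
    have := l.2
    simp only [hS]
    rw [dif_pos ⟨by omega, by omega⟩]
    congr 1
  have h0 : S 0 = 1 := by simp [hS]
  have hstep : ∀ r < n, S (r + 1) = S r ∨ S (r + 1) = S r + 1 := by
    intro r hr
    rcases r with _ | r
    · have h1 := hs ⟨0, hr⟩
      have h2 := hSl ⟨0, hr⟩
      have h3 := h1.1
      have h4 := h1.2.1
      simp only at h2 h4
      omega
    · have h1 := hSl ⟨r + 1, hr⟩
      have h2 := hSl ⟨r, by omega⟩
      simp only at h1 h2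
      rw [h1, h2]
      obtain ⟨a1, a2, a3⟩ := hs ⟨r + 1, hr⟩
      obtain ⟨b1, b2, b3⟩ := hs ⟨r, by omega⟩
      have ht2 := ht.2 ⟨r, by omega⟩ hr
      simp only at a2 a3 b2 b3 ht2
      by_contra hne
      rcases Nat.lt_or_ge (s ⟨r + 1, hr⟩) (s ⟨r, by omega⟩) with h | h
      · have e1 := (ht2 ⟨s ⟨r + 1, hr⟩ - 1, by omega⟩).1
        rw [Fin.le_def, b3, a3, Fin.val_castSucc, if_neg (by simp only; omega),
          if_pos (by simp only; omega)] at e1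
        omega
      · have e1 := (ht2 ⟨s ⟨r, by omega⟩ - 1, by omega⟩).2
        rw [Fin.lt_def, b3, a3, Fin.val_succ, if_neg (by simp only; omega),
          if_pos (by simp only; omega)] at e1
        simp only at e1
        omega
  refine ⟨(Finset.range n).filter fun r => S (r + 1) = S r + 1, Finset.filter_subset _ _, ?_⟩
  have hc : ∀ r ≤ n, countBelow ((Finset.range n).filter fun r => S (r + 1) = S r + 1) r + 1 =
      S r := by
    intro r
    induction r with
    | zero => intro _; simp [countBelow, h0]
    | succ r ih =>
      intro hr
      have h1 := ih (by omega)
      rw [countBelow_succ, ← Nat.add_right_comm, h1]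
      simp only [Finset.mem_filter, Finset.mem_range, show r < n by omega, true_and]
      split_ifs with h2
      · exact h2.symm
      · have := hstep r (by omega); omega
  funext l k
  ext
  have h1 := hc (l + 1) (by have := l.2; omega)
  rw [hSl] at h1
  rw [triangleOf_val, (hs l).2.2 k, ← h1]
  simp only [Nat.add_lt_add_iff_right]

theorem monoBar_triangleOf (c : Fin (n + 1) → ℤ → ℂˣ) {P : Finset ℕ}
    (hP : P ⊆ Finset.range (n + 1)) : (monoBar (triangleOf (n + 1) P) c : ℂ) =
      stepWeight (fun m => extend fun i => c i (((n + 1 : ℕ) : ℤ) - m)) n P := by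
  rw [monoBar, mono, Fin.prod_univ_castSucc, Units.val_mul, stepWeight, Units.coe_prod,
    Finset.prod_range]
  congr 1
  · refine Finset.prod_congr rfl fun i _ => ?_
    have hi := i.2
    have e1 := countBelow_succ P i
    have e2 := countBelow_succ P (i + 1)
    have l1 := label_triangleOf (n := n + 1) P (r := (i : ℕ) + 1 + 1) (by omega)
    have l2 := label_triangleOf (n := n + 1) P (r := (i : ℕ) + 1) (by omega)
    have l3 := label_triangleOf (n := n + 1) P (r := (i : ℕ) + 1 - 1) (by omega)
    have hI : IsTypeI (triangleOf (n + 1) P) ((i : ℕ) + 1) ↔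
        (i : ℕ) ∉ P ∧ (i : ℕ) + 1 ∈ P := by
      rw [IsTypeI, l1, l2, l3, Nat.add_sub_cancel]
      split_ifs at e1 e2 <;> simp_all
    have hIV : IsTypeIV (triangleOf (n + 1) P) ((i : ℕ) + 1) ↔
        (i : ℕ) ∈ P ∧ (i : ℕ) + 1 ∉ P := by
      rw [IsTypeIV, l1, l2, l3, Nat.add_sub_cancel]
      split_ifs at e1 e2 <;> simp_all
    have hj : ((n + 1 : ℕ) : ℤ) - ((countBelow P ((i : ℕ) + 1) + 1 : ℕ) : ℤ) + 1 =
        ((n + 1 : ℕ) : ℤ) - (countBelow P ((i : ℕ) + 1) : ℕ) := by push_cast; ring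
    simp only [Fin.val_castSucc, hI, hIV, rowWeight, extend, l2, hj,
      dif_pos (show (i : ℕ) < n + 1 by omega)]
    split_ifs <;> simp <;> rfl
  · have e1 := countBelow_succ P n
    have l1 := label_triangleOf_last (n := n + 1) P
    have l2 := label_triangleOf (n := n + 1) P (r := n + 1) le_rfl
    have l3 := label_triangleOf (n := n + 1) P (r := n + 1 - 1) (by omega)
    have hI : IsTypeI (triangleOf (n + 1) P) (n + 1) ↔ n ∉ P := by
      rw [IsTypeI, l1, l2, l3, Nat.add_sub_cancel]
      split_ifs at e1 <;> simp_all
    have hIV : IsTypeIV (triangleOf (n + 1) P) (n + 1) ↔ n ∈ P := by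
      rw [IsTypeIV, l1, l2, l3, Nat.add_sub_cancel]
      split_ifs at e1 <;> simp_all
    have hj : ((n + 1 : ℕ) : ℤ) - ((P.card + 1 : ℕ) : ℤ) + 1 =
        ((n + 1 : ℕ) : ℤ) - (P.card : ℕ) := by push_cast; ring
    rw [countBelow_of_subset hP] at l2
    simp only [Fin.val_last, hI, hIV, extend, l2, hj, dif_pos (Nat.lt_succ_self n)]
    split_ifs <;> simp <;> rfl

theorem sum_monoBar (n : ℕ) (c : Fin (n + 1) → ℤ → ℂˣ) :
    ∑ δ ∈ triangles (n + 1) \ {lowestTriangle (n + 1)}, (monoBar δ c : ℂ) =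
      mat (Theta c) (cutSpin (n + 1)) (topSpin (n + 1)) := by
  rw [mat_Theta_apply, ← sum_stepWeight_ne]
  symm
  refine Finset.sum_nbij (triangleOf (n + 1)) (fun P hP => ?_) (fun P hP Q hQ h => ?_)
    (fun t ht => ?_) (fun P hP => ?_)
  · simp only [Finset.mem_sdiff, Finset.mem_powerset, Finset.mem_singleton] at hP ⊢
    refine ⟨triangleOf_mem P, fun h => hP.2 ?_⟩
    rw [← triangleOf_range] at h
    exact triangleOf_injOn hP.1 (subset_refl (Finset.range (n + 1))) h
  · simp only [Finset.mem_coe, Finset.mem_sdiff, Finset.mem_powerset] at hP hQ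
    exact triangleOf_injOn hP.1 hQ.1 h
  · simp only [Finset.coe_sdiff, Finset.coe_singleton, Set.mem_sdiff, Finset.mem_coe, triangles,
      Finset.mem_filter, Set.mem_singleton_iff] at ht
    obtain ⟨P, hP, rfl⟩ := exists_triangleOf_eq ht.1.2
    refine ⟨P, ?_, rfl⟩
    simp only [Finset.mem_coe, Finset.mem_sdiff, Finset.mem_powerset, Finset.mem_singleton]
    refine ⟨hP, ?_⟩
    rintro rfl
    exact ht.2 triangleOf_range
  · simp only [Finset.mem_sdiff, Finset.mem_powerset] at hP
    exact (monoBar_triangleOf c hP.1).symm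

end TypeB

open TypeB
theorem mainTheorem7 (n : ℕ) (hn : 1 ≤ n) (w₀ : Equiv.Perm (Weight n)) (hw₀ : IsLongest w₀) :
    (∃! D : G n → ℂ,
      IsGeneralizedMinor (fundWeight (lastIdx n hn))
        (w₀ (simpleReflection (lastIdx n hn) (fundWeight (lastIdx n hn))))
        (fundWeight (lastIdx n hn)) D) ∧
    ∀ D : G n → ℂ,
      IsGeneralizedMinor (fundWeight (lastIdx n hn))
        (w₀ (simpleReflection (lastIdx n hn) (fundWeight (lastIdx n hn))))
        (fundWeight (lastIdx n hn)) D →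
      ∀ c : Fin n → ℤ → ℂˣ,
        D (Theta c) = ∑ δ ∈ triangles n \ {lowestTriangle n}, (monoBar δ c : ℂ) := by
  refine ⟨⟨_, (isGeneralizedMinor_iff hn hw₀ _).2 rfl, fun D hD =>
    (isGeneralizedMinor_iff hn hw₀ D).1 hD⟩, fun D hD c => ?_⟩
  obtain rfl := (isGeneralizedMinor_iff hn hw₀ D).1 hD
  obtain ⟨k, rfl⟩ : ∃ k, n = k + 1 := ⟨n - 1, by omega⟩
  exact (sum_monoBar k c).symm
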